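/- **Setting.** Let $\mathcal C=\prod_{i=1}^{q}\{1,\dots,N_i\}$ (all $N_i\ge 1$) be a combinatorial space with $|\mathcal C|=N$, let $m$ be the least integer with $2^m\ge N$, and let $c\mapsto b(c)\in\{0,1\}^m$ be an injective Boolean coding. Let $R\in\mathbb R^{d\times m}$ be a random matrix, $\phi(c)=Rb(c)$, and for $\varepsilon\in(0,1)$ let $E$ be the event, assumed to have positive probability, that $\phi$ is a $(1\pm\varepsilon)$-distortion embedding: $$(1-\varepsilon)\|b(c)-b(c')\|_1\le\|\phi(c)-\phi(c')\|_2^2\le(1+\varepsilon)\|b(c)-b(c')\|_1\qquad\text{for all }c,c'\in\mathcal C .$$ Let $k$ be a measurable positive-definite (i.e. all Gram matrices are positive semidefinite) kernel on $\mathbb R^d$ with values in $[0,k_{\max}]$, put $\tilde k(c,c')=k(\phi(c),\phi(c'))$, and let $\mathcal H_{\mathcal C}$ be the RKHS of $\tilde k$. The objective $f:\mathcal C\to\mathbb R$ is to be minimized. Querying $c$ returns $f(c)$ plus noise; the noise variables are i.i.d. $\mathcal N(0,\sigma_n^2)$ with $\sigma_n>0$, and independent of $(R,f)$. GP-UCB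 starts from any finite fixed initial design (possibly empty) and its observations; at iteration $t=1,2,\dots$ it queries a minimizer $c_t$ over $\mathcal C$ of $\mu_t(\phi(c))-\beta_t\sigma_t(\phi(c))$ (ties being broken by a fixed measurable rule), where $\mu_t$ and $\sigma_t$ are the posterior mean and standard deviation of Gaussian process regression with kernel $k$ and noise variance $\sigma_n^2$ on all data observed so far. Let $R_T=\sum_{t=1}^{T}\bigl(f(c_t)-\min_{\mathcal C} f\bigr)$, let $\delta\in(0,1)$, and put $$b_t=\sqrt{2\log\frac{\pi^2Nt^2}{6\delta}} .$$ **Theorem.** There is an absolute constant $M>0$ such that the following holds in every such setting. Suppose $\beta_t\le A\sqrt{\log(Nt/\delta)}$ for all $t\ge1$, and that, for almost every outcome in $E$, one of the following two alternatives holds (the same one throughout): 1. $f\in\mathcal H_{\mathcal C}$ with $\|f\|_{\mathcal H_{\mathcal C}}\le B$ (for instance $f$ non-random), and $\beta_t\ge B+\sqrt N\,b_t$ for all $t\ge1$; or 2. conditionally on $R$, $f$ is a sample of the centered Gaussian process on $\mathcal C$ with covariance $\tilde k$, and $\beta_t\ge b_t$ for all $t\ge1$. Then, conditionally on $E$, with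 probability at least $1-\delta$ all of the following hold simultaneously: * for all $T\ge1$: $\displaystyle R_T\le MA\Bigl(1+\sqrt{\tfrac{k_{\max}}{\sigma_n^2+\varepsilon^2}}\Bigr)\sqrt{(\sigma_n^2+\varepsilon^2)\,N\,T\log(NT/\delta)}$; * for all $T\ge1$ with $T\ge k_{\max}N/(\sigma_n^2+\varepsilon^2)$: $\displaystyle R_T\le MA\sqrt{(\sigma_n^2+\varepsilon^2)\,N\,T\log(NT/\delta)}$; * $R_T/T\to0$ as $T\to\infty$. In particular $R_T=O\bigl(\sqrt{(\sigma_n^2+\varepsilon^2)NT\log(NT/\delta)}\bigr)$. In alternative 2 and for $N\ge2$ one may take $\beta_t=b_t$ and $A$ an absolute constant; in alternative 1, $A$ has to depend on $B$ and $N$. -/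

import Mathlib

open MeasureTheory ProbabilityTheory Filter Topology
open scoped Matrix

namespace CBO

noncomputable section

/-- The combinatorial space: `q` categorical variables, the `i`-th one with `sizes i` values. -/
abbrev Comb {q : ℕ} (sizes : Fin q → ℕ) : Type := (i : Fin q) → Fin (sizes i)

/-- A Boolean vector, read as a vector with real entries `0` and `1`. -/
def boolVec {m : ℕ} (b : Fin m → Bool) : Fin m → ℝ := fun j => if b j then 1 else 0

/-- The linear map `b ↦ R b` from Boolean vectors into Euclidean space `ℝ^d`. -/
def embed {d m : ℕ} (R : Fin d → Fin m → ℝ) (b : Fin m → Bool) : EuclideanSpace ℝ (Fin d) :=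
  WithLp.toLp 2 (Matrix.of R *ᵥ boolVec b)

/-- `φ(c) = R b(c)` is a `(1 ± ε)`-distortion embedding: squared Euclidean distances agree with the
`ℓ¹` (Hamming) distances of the Boolean codes up to a factor `1 ± ε`. -/
def LowDistortion {C : Type} {d m : ℕ} (code : C → Fin m → Bool) (ε : ℝ)
    (R : Fin d → Fin m → ℝ) : Prop :=
  ∀ c c' : C,
    (1 - ε) * ∑ j, |boolVec (code c) j - boolVec (code c') j|
        ≤ ‖embed R (code c) - embed R (code c')‖ ^ 2 ∧
    ‖embed R (code c) - embed R (code c')‖ ^ 2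
        ≤ (1 + ε) * ∑ j, |boolVec (code c) j - boolVec (code c') j|

/-- The kernel `k̃(c, c') = k(φ(c), φ(c'))` on the combinatorial space. -/
def pullKernel {C E : Type} (k : E → E → ℝ) (φ : C → E) : C → C → ℝ :=
  fun c c' => k (φ c) (φ c')

section GaussianProcessRegression

variable {E : Type}

/-- The matrix `K(X, X) + σ² I`. -/
def regGram (k : E → E → ℝ) (σ2 : ℝ) {n : ℕ} (X : Fin n → E) : Matrix (Fin n) (Fin n) ℝ :=
  Matrix.of (fun i j => k (X i) (X j)) + σ2 • (1 : Matrix (Fin n) (Fin n) ℝ)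

/-- The posterior mean `k(x, X) (K(X, X) + σ² I)⁻¹ y` of Gaussian process regression. -/
def postMean (k : E → E → ℝ) (σ2 : ℝ) {n : ℕ} (X : Fin n → E) (y : Fin n → ℝ) (x : E) : ℝ :=
  (fun i => k x (X i)) ⬝ᵥ ((regGram k σ2 X)⁻¹ *ᵥ y)

/-- The posterior variance `k(x, x) - k(x, X) (K(X, X) + σ² I)⁻¹ k(X, x)`. -/
def postVar (k : E → E → ℝ) (σ2 : ℝ) {n : ℕ} (X : Fin n → E) (x : E) : ℝ :=
  k x x - (fun i => k x (X i)) ⬝ᵥ ((regGram k σ2 X)⁻¹ *ᵥ (fun i => k (X i) x))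

/-- The posterior standard deviation. -/
def postStd (k : E → E → ℝ) (σ2 : ℝ) {n : ℕ} (X : Fin n → E) (x : E) : ℝ :=
  Real.sqrt (postVar k σ2 X x)

/-- The GP-UCB acquisition function for minimization, `μ(x) - β σ(x)`. -/
def ucb (k : E → E → ℝ) (σ2 β : ℝ) {n : ℕ} (X : Fin n → E) (y : Fin n → ℝ) (x : E) : ℝ :=
  postMean k σ2 X y x - β * postStd k σ2 X x

end GaussianProcessRegression

/-- A data set of `n` queried combinations and the observed outputs. -/
structure Dataset (C : Type) (n : ℕ) where
  /-- the queried combinations -/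
  pts : Fin n → C
  /-- the observed outputs -/
  obs : Fin n → ℝ

section Algorithm

variable {C E : Type} (k : E → E → ℝ) (σ2 : ℝ) (β : ℕ → ℝ) (φ : C → E) (argmin : (C → ℝ) → C)
  {n₀ : ℕ} (init : Fin n₀ → C) (f : C → ℝ) (η : ℕ → ℝ)

/-- The combination that minimizes the acquisition function over the embedded points, for a given
data set; `argmin` is a rule that picks a minimizer of a function on the combinatorial space. -/
def nextQuery (b : ℝ) {n : ℕ} (D : Dataset C n) : C :=
  argmin (fun c => ucb k σ2 b (fun i => φ (D.pts i)) D.obs (φ c))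

/-- The data available to the algorithm after `s` iterations: the `n₀` initial observations and
then one observation `y = f(c) + noise` per iteration. Iteration `s + 1` uses `β (s + 1)`. -/
def dataAfter : (s : ℕ) → Dataset C (n₀ + s)
  | 0 => { pts := init, obs := fun i => f (init i) + η i }
  | s + 1 =>
    let D := dataAfter s
    let c := nextQuery k σ2 φ argmin (β (s + 1)) D
    { pts := Fin.snoc (α := fun _ => C) D.pts c
      obs := Fin.snoc (α := fun _ => ℝ) D.obs (f c + η (n₀ + s)) }

/-- The combination queried at iteration `s + 1` (so `s` counts from `0`). -/
def query (s : ℕ) : C :=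
  nextQuery k σ2 φ argmin (β (s + 1)) (dataAfter k σ2 β φ argmin init f η s)

/-- The cumulative regret `R_T = ∑_{t = 1}^T (f(c_t) - min f)`. -/
def cumRegret (T : ℕ) : ℝ :=
  ∑ s ∈ Finset.range T, (f (query k σ2 β φ argmin init f η s) - ⨅ c, f c)

end Algorithm

/-- The function `f` lies in the reproducing kernel Hilbert space with kernel `K` and has norm at
most `B` there. -/
def InRKHSBall {C : Type} (K : C → C → ℝ) (B : ℝ) (f : C → ℝ) : Prop :=
  ∃ (H : Type) (_ : NormedAddCommGroup H) (_ : InnerProductSpace ℝ H) (_ : CompleteSpace H)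
    (_ : RKHS ℝ H C ℝ),
    (∀ c c' : C, RKHS.kernel H c c' 1 = K c c') ∧ ∃ g : H, (∀ c, g c = f c) ∧ ‖g‖ ≤ B

/-- The law `ν` on functions on a finite set is that of a centered Gaussian process with
covariance `K`: every linear functional is centered Gaussian with the variance given by `K`. -/
def IsGPLaw {C : Type} [Fintype C] (K : C → C → ℝ) (ν : Measure (C → ℝ)) : Prop :=
  ∀ a : C → ℝ, ν.map (fun g => ∑ c, a c * g c)
    = gaussianReal 0 (∑ c, ∑ c', a c * a c' * K c c').toNNReal

/-- The finite-domain GP-UCB width `√(2 log(N t² π² / (6 δ)))`. -/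
def baseWidth (N : ℕ) (δ : ℝ) (t : ℕ) : ℝ :=
  Real.sqrt (2 * Real.log ((N : ℝ) * (t : ℝ) ^ 2 * Real.pi ^ 2 / (6 * δ)))

/-- The regret rate `√((σ² + ε²) N T log(N T / δ))`. -/
def regretRate (σ ε δ : ℝ) (N T : ℕ) : ℝ :=
  Real.sqrt ((σ ^ 2 + ε ^ 2) * N * T * Real.log ((N : ℝ) * T / δ))

/-- The regret statement for one run with cumulative regret `Reg`, with constant `M`: for all
horizons `T ≥ 1`, the regret is at most the rate times `M (1 + √(kmax / (σ² + ε²)))`; as soon as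
`T ≥ N kmax / (σ² + ε²)`, it is at most the rate times `M`; and the regret is sublinear. -/
def RegretBound (M kmax σ ε δ : ℝ) (N : ℕ) (Reg : ℕ → ℝ) : Prop :=
  (∀ T : ℕ, 1 ≤ T →
    Reg T ≤ M * (1 + Real.sqrt (kmax / (σ ^ 2 + ε ^ 2))) * regretRate σ ε δ N T) ∧
  (∀ T : ℕ, 1 ≤ T → kmax * N / (σ ^ 2 + ε ^ 2) ≤ T → Reg T ≤ M * regretRate σ ε δ N T) ∧
  Tendsto (fun T : ℕ => Reg T / T) atTop (𝓝 0)

end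

end CBO

/-!
The regret of one iteration is at most `2 β_t σ_t(c_t)` as soon as the confidence bound
`|f(c) - μ_t(c)| ≤ w_t σ_t(c)` holds at all points, for a width `w_t ≤ β_t`. The posterior variance is the
minimum of a regularized least squares problem in a feature space (`postVar_eq`, `postVar_le`), so
that it is at most `kmax`, and at most `σ² / m` at a point already observed `m` times. Grouping
the iterations by the queried point, `∑ σ_t(c_t) ≤ D √kmax + 2 σ √(N T)`, where `D ≤ min N T`
counts the visited points (`sum_std_le`); this gives all three regret statements with the constant
`6` (`regretBound_of_not_boundFails`). The low distortion of the embedding is not needed for this: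
it only enters as the event that is conditioned on.

It remains to bound the probability that the confidence bound ever fails by `δ`, for almost every
embedding. The kernel enters the algorithm only through its values on the combinatorial space, so
that a run is a function of the pulled back kernel, the objective and the noise.

* For an objective in the RKHS (`noiseLaw_boundFails_le`), the bias of the posterior mean is at
  most `B σ_t(c)` by Cauchy-Schwarz. Its noise part weights all observations of one point equally,
  and is therefore controlled by the `N` noise sums at the single points, at the price of a factor
  `√N`. The queries depend on the noise, but the sum of exactly `n` predictably selected Gaussian
  variables is Gaussian (`map_sum_predictable`), which yields the tail bound `selection_tail`.
* For an objective drawn from the Gaussian process (`prod_boundFails_le`), a run up to a given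
  iteration has one of finitely many designs. For a fixed design, the posterior error is a
  Gaussian variable of variance `σ_t(c)²`, independent of the observations (`indepFun_postError`),
  while the event that the run has this design depends on the observations only.

In both cases the widths `b_t` make the union bound over the points and the iterations add up to
exactly `δ` (`tsum_exp_baseWidth`); this uses the two-sided Gaussian tail bound without a factor
`2` (`gaussianReal_abs_tail_le`).
-/

namespace CBO

/-! ### Gaussian tails and adaptively selected noise -/

/-- Halving the two-sided union bound: the reflected halves of the tail each cost half of
`exp (-b² / 2)`, so no factor `2` appears. -/
theorem gaussianReal_abs_tail_le (v : NNReal) {b : ℝ} (hb : 0 ≤ b) :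
    gaussianReal 0 v {x : ℝ | b * Real.sqrt v < |x|} ≤ ENNReal.ofReal (Real.exp (-b ^ 2 / 2)) := by
  rcases eq_or_ne v 0 with rfl | hv
  · simp [gaussianReal_zero_var]
  set s := Real.sqrt v with hs
  have hs0 : 0 ≤ s := Real.sqrt_nonneg _
  have hs2 : s ^ 2 = v := Real.sq_sqrt v.2
  have hvpos : (0 : ℝ) < v := by exact_mod_cast pos_iff_ne_zero.mpr hv
  set e := ENNReal.ofReal (Real.exp (-b ^ 2 / 2)) with he
  -- beyond `b s`, the density is at most `exp (-b² / 2)` times the density centered at `b s`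
  have hpdf : ∀ x ∈ Set.Ioi (b * s), gaussianPDF 0 v x ≤ e * gaussianPDF (b * s) v x := by
    intro x hx
    have hx' : b * s < x := hx
    rw [gaussianPDF, gaussianPDF, he, ← ENNReal.ofReal_mul (Real.exp_nonneg _)]
    apply ENNReal.ofReal_le_ofReal
    rw [gaussianPDFReal, gaussianPDFReal, mul_left_comm, ← Real.exp_add]
    gcongr
    rw [← sub_nonneg]
    have : -b ^ 2 / 2 + -(x - b * s) ^ 2 / (2 * (v : ℝ)) - -(x - 0) ^ 2 / (2 * (v : ℝ))
        = b * s * (x - b * s) / v := by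
      field_simp
      rw [← hs2]; ring
    rw [this]
    exact div_nonneg (mul_nonneg (mul_nonneg hb hs0) (by linarith)) hvpos.le
  have hright : gaussianReal 0 v (Set.Ioi (b * s)) ≤ e * gaussianReal 0 v (Set.Ioi 0) := by
    have h1 : gaussianReal 0 v (Set.Ioi 0) = gaussianReal (b * s) v (Set.Ioi (b * s)) := by
      have := gaussianReal_map_add_const (μ := 0) (v := v) (b * s)
      rw [zero_add] at this
      rw [← this, Measure.map_apply (by fun_prop) measurableSet_Ioi]
      congr 1; ext x; simp
    rw [h1, gaussianReal_apply _ hv, gaussianReal_apply _ hv,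
      ← lintegral_const_mul _ (measurable_gaussianPDF _ _)]
    exact setLIntegral_mono ((measurable_gaussianPDF _ _).const_mul _) hpdf
  have hneg : ∀ t : ℝ, gaussianReal 0 v (Set.Iio (-t)) = gaussianReal 0 v (Set.Ioi t) := by
    intro t
    have := gaussianReal_map_neg (μ := 0) (v := v)
    rw [neg_zero] at this
    conv_lhs => rw [← this, Measure.map_apply (by fun_prop) measurableSet_Iio]
    congr 1; ext x; simp
  have hsub : {x : ℝ | b * s < |x|} ⊆ Set.Ioi (b * s) ∪ Set.Iio (-(b * s)) := by
    intro x hx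
    rw [Set.mem_ofPred_eq, lt_abs] at hx
    rcases hx with h | h
    · exact Or.inl h
    · exact Or.inr (by simp only [Set.mem_Iio]; linarith)
  calc gaussianReal 0 v {x : ℝ | b * s < |x|}
      ≤ gaussianReal 0 v (Set.Ioi (b * s)) + gaussianReal 0 v (Set.Iio (-(b * s))) :=
        (measure_mono hsub).trans (measure_union_le _ _)
    _ ≤ e * gaussianReal 0 v (Set.Ioi 0) + e * gaussianReal 0 v (Set.Iio 0) := by
        have h0 := hneg 0
        rw [neg_zero] at h0
        rw [hneg, h0]; exact add_le_add hright hright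
    _ = e * gaussianReal 0 v (Set.Ioi 0 ∪ Set.Iio 0) := by
        rw [measure_union _ measurableSet_Iio, mul_add]
        exact Set.disjoint_left.mpr fun x hx hx' => lt_asymm (Set.mem_Ioi.mp hx) hx'
    _ ≤ e := by
        calc _ ≤ e * 1 := by gcongr; exact prob_le_one
          _ = e := mul_one e

/-- The law of a sequence of independent centered Gaussian variables of variance `v`. -/
noncomputable abbrev noiseLaw (v : NNReal) : Measure (ℕ → ℝ) :=
  Measure.infinitePi (fun _ : ℕ => gaussianReal 0 v)

/-- `g` is predictable at time `i`: it is measurable and depends only on the coordinates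
before `i`. -/
structure PredictableAt {β : Type*} [MeasurableSpace β] (i : ℕ) (g : (ℕ → ℝ) → β) : Prop where
  measurable : Measurable g
  congr : ∀ η η' : ℕ → ℝ, (∀ j < i, η j = η' j) → g η = g η'

/-- A sequence that agrees with a given finite initial piece and vanishes afterwards. -/
def extendZero (i : ℕ) (a : Finset.range i → ℝ) : ℕ → ℝ :=
  fun j => if h : j ∈ Finset.range i then a ⟨j, h⟩ else 0

theorem measurable_extendZero (i : ℕ) : Measurable (extendZero i) := by
  refine measurable_pi_lambda _ fun j => ?_
  unfold extendZero
  split_ifs <;> fun_prop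

theorem PredictableAt.extendZero_restrict {β : Type*} [MeasurableSpace β] {i : ℕ}
    {g : (ℕ → ℝ) → β} (hg : PredictableAt i g) (η : ℕ → ℝ) :
    g (extendZero i (fun j => η j)) = g η :=
  hg.congr _ _ fun j hj => by simp [extendZero, hj]

/-- Integrating out the `n`-th noise variable, which is independent of everything predictable. -/
theorem integral_predictable_mul_exp (v : NNReal) {n : ℕ} {G : (ℕ → ℝ) → ℂ} {e : (ℕ → ℝ) → ℝ}
    (hG : PredictableAt n G) (he : PredictableAt n e) {B : ℝ} (hB : ∀ η, ‖G η‖ ≤ B) (θ : ℝ) :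
    ∫ η, G η * Complex.exp (θ * e η * η n * Complex.I) ∂(noiseLaw v)
      = ∫ η, G η * Complex.exp (-(v * (θ * e η) ^ 2 / 2)) ∂(noiseLaw v) := by
  have hind : iIndepFun (fun (i : ℕ) (η : ℕ → ℝ) => η i) (noiseLaw v) :=
    iIndepFun_infinitePi (P := fun _ : ℕ => gaussianReal 0 v) (X := fun _ x => x)
      (fun _ => measurable_id)
  have hpair : IndepFun (fun (η : ℕ → ℝ) (j : Finset.range n) => η j)
      (fun η : ℕ → ℝ => η n) (noiseLaw v) := by
    have := hind.indepFun_finset (Finset.range n) {n} (by simp) (fun i => measurable_pi_apply i)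
    exact this.comp (φ := id) (ψ := fun a : ({n} : Finset ℕ) → ℝ => a ⟨n, by simp⟩) measurable_id
      (by fun_prop)
  have hm : Measurable (fun (η : ℕ → ℝ) (j : Finset.range n) => η j) := by fun_prop
  have hn : Measurable (fun η : ℕ → ℝ => η n) := by fun_prop
  rw [indepFun_iff_map_prod_eq_prod_map_map hm.aemeasurable hn.aemeasurable] at hpair
  have hlaw : (noiseLaw v).map (fun η : ℕ → ℝ => η n) = gaussianReal 0 v :=
    Measure.infinitePi_map_eval _ n
  rw [hlaw] at hpair
  set μ := (noiseLaw v).map (fun (η : ℕ → ℝ) (j : Finset.range n) => η j) with hμ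
  have : IsProbabilityMeasure μ := Measure.isProbabilityMeasure_map hm.aemeasurable
  have hG' : Measurable (fun a => G (extendZero n a)) := hG.1.comp (measurable_extendZero n)
  have he' : Measurable (fun a => e (extendZero n a)) := he.1.comp (measurable_extendZero n)
  set H : (Finset.range n → ℝ) × ℝ → ℂ := fun q =>
    G (extendZero n q.1) * Complex.exp (θ * e (extendZero n q.1) * q.2 * Complex.I) with hH
  have hHm : Measurable H := by
    have h1 : Measurable fun q : (Finset.range n → ℝ) × ℝ => G (extendZero n q.1) :=
      hG'.comp measurable_fst
    have h2 : Measurable fun q : (Finset.range n → ℝ) × ℝ => e (extendZero n q.1) :=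
      he'.comp measurable_fst
    exact h1.mul ((((measurable_const.mul (Complex.measurable_ofReal.comp h2)).mul
      (Complex.measurable_ofReal.comp measurable_snd)).mul measurable_const).cexp)
  have hHb : ∀ q, ‖H q‖ ≤ B := by
    intro q
    have : (θ * e (extendZero n q.1) * q.2 * Complex.I : ℂ)
        = ((θ * e (extendZero n q.1) * q.2 : ℝ) : ℂ) * Complex.I := by push_cast; ring
    rw [hH]
    simp only [norm_mul, this, Complex.norm_exp_ofReal_mul_I, mul_one]
    exact hB _
  have hHi : Integrable H (μ.prod (gaussianReal 0 v)) :=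
    Integrable.of_bound hHm.aestronglyMeasurable B (ae_of_all _ hHb)
  have h1 : ∫ η, G η * Complex.exp (θ * e η * η n * Complex.I) ∂(noiseLaw v)
      = ∫ q, H q ∂(μ.prod (gaussianReal 0 v)) := by
    rw [← hpair, integral_map (hm.prodMk hn).aemeasurable hHm.aestronglyMeasurable]
    refine integral_congr_ae (ae_of_all _ fun η => ?_)
    simp only [hH, hG.extendZero_restrict, he.extendZero_restrict]
  have h2 : ∫ η, G η * Complex.exp (-(v * (θ * e η) ^ 2 / 2)) ∂(noiseLaw v)
      = ∫ a, G (extendZero n a) * Complex.exp (-(v * (θ * e (extendZero n a)) ^ 2 / 2)) ∂μ := by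
    rw [hμ, integral_map hm.aemeasurable]
    · refine integral_congr_ae (ae_of_all _ fun η => ?_)
      simp only [hG.extendZero_restrict, he.extendZero_restrict]
    · exact (hG'.mul (Measurable.cexp (((measurable_const.mul
        ((measurable_const.mul (Complex.measurable_ofReal.comp he')).pow_const 2)).div_const
          2).neg))).aestronglyMeasurable
  rw [h1, h2, integral_prod _ hHi]
  refine integral_congr_ae (ae_of_all _ fun a => ?_)
  simp only [hH]
  rw [integral_const_mul]
  congr 1
  have := charFun_gaussianReal (μ := 0) (v := v) (θ * e (extendZero n a))
  rw [charFun_apply_real] at this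
  push_cast at this
  rw [this]
  congr 1; ring

/-- Predictably chosen noise variables, exactly `n` of them, sum up to a centered Gaussian of
variance `n v`: the exponential martingale `exp (i θ S + θ² v n / 2)` has expectation `1`. -/
theorem map_sum_predictable (v : NNReal) (p : ℕ → (ℕ → ℝ) → Prop)
    [∀ i η, Decidable (p i η)]
    (hp : ∀ i, PredictableAt i (fun η => if p i η then (1 : ℝ) else 0)) (K n : ℕ)
    (hn : ∀ η, ∑ j ∈ Finset.range K, (if p j η then (1 : ℝ) else 0) = n) :
    (noiseLaw v).map (fun η => ∑ j ∈ Finset.range K, if p j η then η j else 0)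
      = gaussianReal 0 (n * v) := by
  have hmS : ∀ L, Measurable fun η : ℕ → ℝ => ∑ j ∈ Finset.range L, if p j η then η j else 0 := by
    intro L
    have : (fun η : ℕ → ℝ => ∑ j ∈ Finset.range L, if p j η then η j else 0)
        = fun η => ∑ j ∈ Finset.range L, (if p j η then (1 : ℝ) else 0) * η j := by
      ext η; refine Finset.sum_congr rfl fun j _ => ?_; split_ifs <;> simp
    rw [this]
    refine Finset.measurable_fun_sum _ fun j _ => ?_
    exact (hp j).1.mul (measurable_pi_apply j)
  have key : ∀ (θ : ℝ) (L : ℕ), ∫ η, Complex.exp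
      (((θ * ∑ j ∈ Finset.range L, if p j η then η j else 0 : ℝ) : ℂ) * Complex.I
        + ((v * θ ^ 2 / 2 * ∑ j ∈ Finset.range L, (if p j η then (1 : ℝ) else 0) : ℝ) : ℂ))
        ∂(noiseLaw v) = 1 := by
    intro θ L
    induction L with
    | zero => simp
    | succ L ih =>
      set e : (ℕ → ℝ) → ℝ := fun η => if p L η then (1 : ℝ) else 0 with he
      -- the variance term of step `L` is predictable, so it goes into the predictable factor
      set G : (ℕ → ℝ) → ℂ := fun η => Complex.exp
        (((θ * ∑ j ∈ Finset.range L, if p j η then η j else 0 : ℝ) : ℂ) * Complex.I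
        + ((v * θ ^ 2 / 2 * ∑ j ∈ Finset.range (L + 1), (if p j η then (1 : ℝ) else 0) : ℝ) : ℂ))
        with hGdef
      have hG : PredictableAt L G := by
        constructor
        · have h1 := hmS L
          have h2 : Measurable fun η : ℕ → ℝ =>
              ∑ j ∈ Finset.range (L + 1), (if p j η then (1 : ℝ) else 0) :=
            Finset.measurable_fun_sum _ fun j _ => (hp j).1
          fun_prop
        · intro η η' h
          have hj : ∀ j ≤ L, (p j η ↔ p j η') := by
            intro j hj
            have := (hp j).2 η η' fun l hl => h l (by omega)
            by_cases h1 : p j η <;> by_cases h2 : p j η' <;> simp_all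
          have e1 : ∀ j ∈ Finset.range L,
              (if p j η then η j else 0) = (if p j η' then η' j else 0) := by
            intro j hjL
            have hjL := Finset.mem_range.mp hjL
            rw [h j hjL]; simp only [hj j hjL.le]
          have e2 : ∀ j ∈ Finset.range (L + 1),
              (if p j η then (1 : ℝ) else 0) = (if p j η' then 1 else 0) := by
            intro j hjL
            have hjL := Finset.mem_range.mp hjL
            simp only [hj j (by omega)]
          simp only [hGdef]
          rw [Finset.sum_congr rfl e1, Finset.sum_congr rfl e2]
      have hGB : ∀ η, ‖G η‖ ≤ Real.exp (v * θ ^ 2 / 2 * (L + 1)) := by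
        intro η
        rw [hGdef]
        simp only [Complex.norm_exp]
        apply Real.exp_le_exp.mpr
        simp only [Complex.add_re, Complex.re_ofReal_mul, Complex.I_re, mul_zero,
          Complex.ofReal_re, zero_add]
        gcongr
        calc ∑ j ∈ Finset.range (L + 1), (if p j η then (1 : ℝ) else 0)
            ≤ ∑ j ∈ Finset.range (L + 1), (1 : ℝ) :=
              Finset.sum_le_sum fun j _ => by split_ifs <;> norm_num
          _ = L + 1 := by simp
      have step := integral_predictable_mul_exp v hG (hp L) hGB θ
      have hl : ∀ η : ℕ → ℝ, Complex.exp
          (((θ * ∑ j ∈ Finset.range (L + 1), if p j η then η j else 0 : ℝ) : ℂ) * Complex.I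
          + ((v * θ ^ 2 / 2 * ∑ j ∈ Finset.range (L + 1), (if p j η then (1 : ℝ) else 0) : ℝ) : ℂ))
          = G η * Complex.exp (θ * (if p L η then (1 : ℝ) else 0 : ℝ) * η L * Complex.I) := by
        intro η
        rw [hGdef, ← Complex.exp_add]
        congr 1
        rw [Finset.sum_range_succ (fun j => if p j η then η j else 0)]
        split_ifs <;> push_cast <;> ring
      have hr : ∀ η : ℕ → ℝ, G η * Complex.exp
            (-(v * (θ * (if p L η then (1 : ℝ) else 0 : ℝ)) ^ 2 / 2))
          = Complex.exp
          (((θ * ∑ j ∈ Finset.range L, if p j η then η j else 0 : ℝ) : ℂ) * Complex.I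
          + ((v * θ ^ 2 / 2 * ∑ j ∈ Finset.range L, (if p j η then (1 : ℝ) else 0) : ℝ) : ℂ)) := by
        intro η
        rw [hGdef, ← Complex.exp_add]
        congr 1
        rw [Finset.sum_range_succ (fun j => if p j η then (1 : ℝ) else 0)]
        split_ifs <;> push_cast <;> ring
      simp_rw [hl]
      rw [step]
      simp_rw [hr]
      exact ih
  have : IsProbabilityMeasure ((noiseLaw v).map
      (fun η => ∑ j ∈ Finset.range K, if p j η then η j else 0)) :=
    Measure.isProbabilityMeasure_map (hmS K).aemeasurable
  refine Measure.ext_of_charFun ?_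
  ext θ
  rw [charFun_gaussianReal, charFun_apply_real, integral_map (hmS K).aemeasurable
    (by apply Measurable.aestronglyMeasurable; fun_prop)]
  have h := key θ K
  simp_rw [hn, Complex.exp_add, integral_mul_const] at h
  have h' := eq_div_of_mul_eq (Complex.exp_ne_zero _) h
  push_cast at h' ⊢
  rw [h', one_div, ← Complex.exp_neg]
  congr 1; ring

/-- Picking only as long as fewer than `n` items have been picked. -/
theorem count_stopped (q : ℕ → Prop) [DecidablePred q] (n K : ℕ) :
    Nat.count (fun j => q j ∧ Nat.count q j < n) K = min (Nat.count q K) n := by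
  induction K with
  | zero => simp
  | succ K ih =>
    rw [Nat.count_succ, Nat.count_succ, ih]
    by_cases h : q K <;> by_cases h' : Nat.count q K < n <;> simp [h, h'] <;> omega

/-- If exactly `n` picks occur before time `i`, then stopping after `n`
picks freezes the sum at its value at time `i`. -/
theorem sum_stopped (q : ℕ → Prop) [DecidablePred q] (x : ℕ → ℝ) {n i K : ℕ}
    (hi : Nat.count q i = n) (hiK : i ≤ K) :
    ∑ j ∈ Finset.range K, (if q j ∧ Nat.count q j < n then x j else 0)
      = ∑ j ∈ Finset.range i, if q j then x j else 0 := by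
  rw [← Finset.sum_range_add_sum_Ico _ hiK]
  have h2 : ∑ j ∈ Finset.Ico i K, (if q j ∧ Nat.count q j < n then x j else 0) = 0 := by
    refine Finset.sum_eq_zero fun j hj => ?_
    have := Nat.count_monotone q (Finset.mem_Ico.mp hj).1
    rw [if_neg]; omega
  rw [h2, add_zero]
  refine Finset.sum_congr rfl fun j hj => ?_
  by_cases h : q j
  · have h1 := Nat.count_monotone q (Nat.succ_le_of_lt (Finset.mem_range.mp hj))
    rw [Nat.count_succ, if_pos h] at h1
    rw [if_pos ⟨h, by omega⟩, if_pos h]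
  · simp [h]

/-- Deviation bound for adaptively chosen noise: at the moment when exactly `n` noise variables
have been picked, their sum is beyond `b` standard deviations with probability at most
`exp (-b² / 2)`. Up to a horizon `L`, the picked variables are padded with later ones to exactly `n`
variables, so that the sum is Gaussian; then `L → ∞`. -/
theorem selection_tail (v : NNReal) (p : ℕ → (ℕ → ℝ) → Prop) [∀ i η, Decidable (p i η)]
    (hp : ∀ i, PredictableAt i (fun η => if p i η then (1 : ℝ) else 0)) (n : ℕ) {b : ℝ}
    (hb : 0 ≤ b) :
    noiseLaw v {η | ∃ i, Nat.count (fun j => p j η) i = n ∧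
        b * Real.sqrt (n * v) < |∑ j ∈ Finset.range i, if p j η then η j else 0|}
      ≤ ENNReal.ofReal (Real.exp (-b ^ 2 / 2)) := by
  set A : ℕ → Set (ℕ → ℝ) := fun L => {η | ∃ i ≤ L, Nat.count (fun j => p j η) i = n ∧
        b * Real.sqrt (n * v) < |∑ j ∈ Finset.range i, if p j η then η j else 0|} with hA
  have hmono : Monotone A := fun L L' h η ⟨i, hi, hi'⟩ => ⟨i, hi.trans h, hi'⟩
  have hU : {η | ∃ i, Nat.count (fun j => p j η) i = n ∧
        b * Real.sqrt (n * v) < |∑ j ∈ Finset.range i, if p j η then η j else 0|} = ⋃ L, A L := by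
    ext η; simp only [hA, Set.mem_ofPred_eq, Set.mem_iUnion]
    exact ⟨fun ⟨i, hi⟩ => ⟨i, i, le_rfl, hi⟩, fun ⟨L, i, _, hi⟩ => ⟨i, hi⟩⟩
  rw [hU, hmono.measure_iUnion]
  refine iSup_le fun L => ?_
  classical
  -- everything is picked from time `L` on, so that `n` picks are complete before time `L + n`
  set q : (ℕ → ℝ) → ℕ → Prop := fun η j => j < L → p j η with hq
  set p' : ℕ → (ℕ → ℝ) → Prop := fun j η => q η j ∧ Nat.count (q η) j < n with hp'
  have hqcongr : ∀ i η η', (∀ j < i, η j = η' j) → (q η i ↔ q η' i) := by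
    intro i η η' h
    have := (hp i).2 η η' h
    have : p i η ↔ p i η' := by
      by_cases h1 : p i η <;> by_cases h2 : p i η' <;> simp_all
    simp only [hq, this]
  have hqmeas : ∀ i, MeasurableSet {η | q η i} := by
    intro i
    by_cases hi : i < L
    · have : {η | q η i} = (fun η => if p i η then (1 : ℝ) else 0) ⁻¹' {1} := by
        ext η; by_cases h1 : p i η <;> simp [hq, hi, h1]
      rw [this]; exact (hp i).1 (measurableSet_singleton 1)
    · have : {η | q η i} = Set.univ := by ext η; simp [hq, hi]
      rw [this]; exact MeasurableSet.univ
  have hcmeas : ∀ i, Measurable fun η => Nat.count (q η) i := by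
    intro i
    induction i with
    | zero => simp
    | succ i ih =>
      simp only [Nat.count_succ]
      exact ih.add (Measurable.ite (hqmeas i) measurable_const measurable_const)
  have hccongr : ∀ i η η', (∀ j < i, η j = η' j) → Nat.count (q η) i = Nat.count (q η') i := by
    intro i η η' h
    induction i with
    | zero => simp
    | succ i ih =>
      simp only [Nat.count_succ]
      rw [ih fun j hj => h j (by omega)]
      simp only [hqcongr i η η' fun j hj => h j (by omega)]
  have hp'pred : ∀ i, PredictableAt i (fun η => if p' i η then (1 : ℝ) else 0) := by
    intro i
    constructor
    · exact Measurable.ite ((hqmeas i).inter ((hcmeas i) (measurableSet_Iio (a := n))))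
        measurable_const measurable_const
    · intro η η' h
      simp only [hp', hqcongr i η η' h, hccongr i η η' h]
  have hcount : ∀ η, ∑ j ∈ Finset.range (L + n), (if p' j η then (1 : ℝ) else 0) = n := by
    intro η
    have h1 := count_stopped (q η) n (L + n)
    have h2 : n ≤ Nat.count (q η) (L + n) := by
      rw [Nat.count_add]
      have : Nat.count (fun k => q η (L + k)) n = n := by
        rw [Nat.count_iff_forall]; intro k _; simp [hq]
      omega
    rw [min_eq_right h2, Nat.count_eq_card_filter_range] at h1
    rw [Finset.sum_boole]
    exact_mod_cast h1
  have hlaw := map_sum_predictable v p' hp'pred (L + n) n hcount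
  have hmeas : Measurable fun η : ℕ → ℝ =>
      ∑ j ∈ Finset.range (L + n), if p' j η then η j else 0 := by
    refine Finset.measurable_fun_sum _ fun j _ => ?_
    exact Measurable.ite ((hqmeas j).inter ((hcmeas j) (measurableSet_Iio (a := n))))
      (measurable_pi_apply j) measurable_const
  have hsub : A L ⊆ (fun η : ℕ → ℝ => ∑ j ∈ Finset.range (L + n), if p' j η then η j else 0) ⁻¹'
      {x : ℝ | b * Real.sqrt ((n * v : NNReal) : ℝ) < |x|} := by
    rintro η ⟨i, hi, hin, hx⟩
    have hcount' : Nat.count (q η) i = n := by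
      rw [← hin, Nat.count_eq_card_filter_range, Nat.count_eq_card_filter_range]
      congr 1
      refine Finset.filter_congr fun j hj => ?_
      have : j < L := (Finset.mem_range.mp hj).trans_le hi
      simp [hq, this]
    have hs := sum_stopped (q η) η hcount' (show i ≤ L + n by omega)
    have hs' : ∑ j ∈ Finset.range i, (if q η j then η j else 0)
        = ∑ j ∈ Finset.range i, if p j η then η j else 0 := by
      refine Finset.sum_congr rfl fun j hj => ?_
      have : j < L := (Finset.mem_range.mp hj).trans_le hi
      simp [hq, this]
    simp only [Set.mem_preimage, Set.mem_ofPred_eq, hp']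
    rw [hs, hs']
    push_cast
    exact hx
  calc noiseLaw v (A L) ≤ _ := measure_mono hsub
    _ = gaussianReal 0 (n * v) {x : ℝ | b * Real.sqrt ((n * v : NNReal) : ℝ) < |x|} := by
        rw [← hlaw, Measure.map_apply hmeas
          (measurableSet_lt measurable_const (by fun_prop))]
    _ ≤ _ := gaussianReal_abs_tail_le _ hb

/-! ### Gaussian process regression through a feature map -/

/-- The weights `α = (K(X, X) + σ² I)⁻¹ K(X, c)` with which the posterior mean at `c` combines the
observations at `X`. -/
noncomputable def postWeights {C : Type} (K : C → C → ℝ) (σ2 : ℝ) {n : ℕ} (X : Fin n → C) (c : C) :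
    Fin n → ℝ :=
  (regGram K σ2 X)⁻¹ *ᵥ (fun i => K (X i) c)

section FeatureMap

variable {C : Type} {H : Type*} [NormedAddCommGroup H] [InnerProductSpace ℝ H] {Φ : C → H}
  {K : C → C → ℝ} (hK : ∀ c c', K c c' = inner ℝ (Φ c) (Φ c')) {σ2 : ℝ} (hσ : 0 < σ2)
  {n : ℕ} (X : Fin n → C) (c : C)

include hK

theorem regGram_mulVec (a : Fin n → ℝ) (i : Fin n) :
    (regGram K σ2 X *ᵥ a) i = inner ℝ (Φ (X i)) (∑ j, a j • Φ (X j)) + σ2 * a i := by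
  rw [regGram, Matrix.add_mulVec, Matrix.smul_mulVec, Matrix.one_mulVec, inner_sum]
  simp only [Pi.add_apply, Pi.smul_apply, smul_eq_mul, Matrix.mulVec, dotProduct, Matrix.of_apply,
    inner_smul_right, hK]
  congr 1
  exact Finset.sum_congr rfl fun j _ => mul_comm _ _

theorem regGram_transpose : (regGram K σ2 X)ᵀ = regGram K σ2 X := by
  ext i j
  simp only [regGram, Matrix.transpose_apply, Matrix.add_apply, Matrix.of_apply,
    Matrix.smul_apply, hK, real_inner_comm (Φ (X i))]
  rw [Matrix.one_apply, Matrix.one_apply]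
  simp only [eq_comm]

include hσ

/-- The regularized Gram matrix is invertible, so that its inverse is not a junk value. -/
theorem isUnit_det_regGram : IsUnit (regGram K σ2 X).det := by
  rw [← Matrix.isUnit_iff_isUnit_det, ← Matrix.mulVec_injective_iff_isUnit]
  have : Function.Injective (regGram K σ2 X).mulVecLin := by
    rw [← LinearMap.ker_eq_bot, LinearMap.ker_eq_bot']
    intro a ha
    have h1 : ∑ i, a i * (regGram K σ2 X *ᵥ a) i = 0 := by
      rw [Matrix.mulVecLin_apply] at ha
      simp [ha]
    simp only [regGram_mulVec hK, mul_add, Finset.sum_add_distrib] at h1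
    have h2 : ∑ i, a i * inner ℝ (Φ (X i)) (∑ j, a j • Φ (X j)) = ‖∑ j, a j • Φ (X j)‖ ^ 2 := by
      rw [← real_inner_self_eq_norm_sq, sum_inner]
      simp [inner_smul_left]
    have h3 : ∑ i, a i * (σ2 * a i) = σ2 * ∑ i, a i ^ 2 := by
      rw [Finset.mul_sum]; exact Finset.sum_congr rfl fun i _ => by ring
    rw [h2, h3] at h1
    have h4 : ∑ i, a i ^ 2 = 0 := by
      have p1 : 0 ≤ ∑ i, a i ^ 2 := Finset.sum_nonneg fun i _ => sq_nonneg _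
      have p2 := sq_nonneg ‖∑ j, a j • Φ (X j)‖
      nlinarith
    rw [Finset.sum_eq_zero_iff_of_nonneg fun i _ => sq_nonneg _] at h4
    ext i
    simpa using h4 i (Finset.mem_univ i)
  exact this

/-- The normal equations for the weights: the residual of the feature vector `Φ c` is orthogonal,
up to the regularization, to the features of the data. -/
theorem inner_residual (i : Fin n) :
    inner ℝ (Φ (X i)) (Φ c - ∑ j, postWeights K σ2 X c j • Φ (X j))
      = σ2 * postWeights K σ2 X c i := by
  have h : regGram K σ2 X *ᵥ postWeights K σ2 X c = fun i => K (X i) c := by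
    rw [postWeights, Matrix.mulVec_mulVec, Matrix.mul_nonsing_inv _ (isUnit_det_regGram hK hσ X),
      Matrix.one_mulVec]
  have h' := congrFun h i
  rw [regGram_mulVec hK, hK] at h'
  rw [inner_sub_right]
  linarith

/-- By the normal equations and `σ² ≠ 0`, the weight of an observation depends only on its
point. -/
theorem postWeights_congr {i j : Fin n} (h : X i = X j) :
    postWeights K σ2 X c i = postWeights K σ2 X c j := by
  have h1 := inner_residual hK hσ X c i
  have h2 := inner_residual hK hσ X c j
  rw [h, h2] at h1
  exact (mul_left_cancel₀ hσ.ne' h1).symm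

omit hσ in
theorem postMean_eq_sum (y : Fin n → ℝ) :
    postMean K σ2 X y c = ∑ i, postWeights K σ2 X c i * y i := by
  have hsymm : (fun i => K c (X i)) = fun i => K (X i) c := by
    ext i; rw [hK, hK, real_inner_comm]
  rw [postMean, hsymm, Matrix.dotProduct_mulVec, ← Matrix.mulVec_transpose,
    Matrix.transpose_nonsing_inv, regGram_transpose hK]
  rfl

/-- The posterior variance is the regularized least squares error of approximating `Φ c` by the
features of the data with the posterior weights; `postVar_le` says that these weights are
optimal. -/
theorem postVar_eq :
    postVar K σ2 X c = ‖Φ c - ∑ j, postWeights K σ2 X c j • Φ (X j)‖ ^ 2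
      + σ2 * ∑ j, postWeights K σ2 X c j ^ 2 := by
  set α := postWeights K σ2 X c with hα
  set r := Φ c - ∑ j, α j • Φ (X j) with hr
  have h1 : postVar K σ2 X c = inner ℝ (Φ c) r := by
    rw [hr, inner_sub_right, inner_sum]
    simp only [inner_smul_right, postVar, hK c]
    congr 1
    exact Finset.sum_congr rfl fun i _ => mul_comm _ _
  have h2 : inner ℝ (∑ j, α j • Φ (X j)) r = σ2 * ∑ j, α j ^ 2 := by
    rw [sum_inner, Finset.mul_sum]
    refine Finset.sum_congr rfl fun j _ => ?_
    rw [real_inner_smul_left, hr, hα, inner_residual hK hσ]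
    ring
  have h3 : Φ c = r + ∑ j, α j • Φ (X j) := by rw [hr]; abel
  rw [h1, ← h2, ← real_inner_self_eq_norm_sq, ← inner_add_left, ← h3]

theorem postVar_nonneg : 0 ≤ postVar K σ2 X c := by
  rw [postVar_eq hK hσ]
  positivity

theorem postVar_le (γ : Fin n → ℝ) :
    postVar K σ2 X c ≤ ‖Φ c - ∑ j, γ j • Φ (X j)‖ ^ 2 + σ2 * ∑ j, γ j ^ 2 := by
  rw [postVar_eq hK hσ]
  set α := postWeights K σ2 X c with hα
  set r := Φ c - ∑ j, α j • Φ (X j) with hr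
  have h1 : Φ c - ∑ j, γ j • Φ (X j) = r - ∑ j, (γ j - α j) • Φ (X j) := by
    simp only [hr, sub_smul, Finset.sum_sub_distrib]; abel
  have h2 : inner ℝ r (∑ j, (γ j - α j) • Φ (X j)) = σ2 * ∑ j, (γ j - α j) * α j := by
    rw [inner_sum, Finset.mul_sum]
    refine Finset.sum_congr rfl fun j _ => ?_
    rw [real_inner_smul_right, real_inner_comm, hr, hα, inner_residual hK hσ]
    ring
  have h3 : ∑ j, γ j ^ 2 = ∑ j, α j ^ 2 + 2 * ∑ j, (γ j - α j) * α j + ∑ j, (γ j - α j) ^ 2 := by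
    rw [Finset.mul_sum, ← Finset.sum_add_distrib, ← Finset.sum_add_distrib]
    exact Finset.sum_congr rfl fun j _ => by ring
  rw [h1, norm_sub_sq_real r, h2, h3]
  have : 0 ≤ σ2 * ∑ j, (γ j - α j) ^ 2 := by positivity
  nlinarith [sq_nonneg ‖∑ j, (γ j - α j) • Φ (X j)‖]

theorem postVar_le_prior : postVar K σ2 X c ≤ K c c := by
  have := postVar_le hK hσ X c 0
  simpa [hK c c, real_inner_self_eq_norm_sq] using this

/-- `s` previous observations of `c` itself bring the posterior variance at `c` down to
`σ² / s`: compare with the plain average of these observations. -/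
theorem postVar_le_div [DecidableEq C] (hs : 0 < (Finset.univ.filter fun i => X i = c).card) :
    postVar K σ2 X c ≤ σ2 / (Finset.univ.filter fun i => X i = c).card := by
  set s := (Finset.univ.filter fun i => X i = c).card with hsdef
  have hs' : (0 : ℝ) < s := by exact_mod_cast hs
  have h := postVar_le hK hσ X c (fun i => if X i = c then (s : ℝ)⁻¹ else 0)
  have e1 : ∑ j, (if X j = c then (s : ℝ)⁻¹ else 0) • Φ (X j) = Φ c := by
    have : ∀ j, (if X j = c then (s : ℝ)⁻¹ else 0) • Φ (X j)
        = if X j = c then (s : ℝ)⁻¹ • Φ c else 0 := by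
      intro j; split_ifs with hj
      · rw [hj]
      · simp
    simp only [this]
    rw [← Finset.sum_filter, Finset.sum_const, ← hsdef, ← Nat.cast_smul_eq_nsmul ℝ, smul_smul,
      mul_inv_cancel₀ hs'.ne', one_smul]
  have e2 : ∑ j, (if X j = c then (s : ℝ)⁻¹ else 0) ^ 2 = (s : ℝ)⁻¹ := by
    simp only [ite_pow]
    rw [zero_pow two_ne_zero, ← Finset.sum_filter, Finset.sum_const, ← hsdef, nsmul_eq_mul]
    field_simp
  rw [e1, e2] at h
  simpa [div_eq_mul_inv] using h

end FeatureMap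

open scoped MatrixOrder Matrix.Norms.L2Operator in
/-- A positive semidefinite kernel on a finite set has a Euclidean feature map. -/
theorem exists_featureMap {C : Type} [Fintype C] {K : C → C → ℝ} (hK : (Matrix.of K).PosSemidef) :
    ∃ Φ : C → EuclideanSpace ℝ C, ∀ c c', K c c' = inner ℝ (Φ c) (Φ c') := by
  classical
  obtain ⟨B, hB⟩ := CStarAlgebra.nonneg_iff_eq_star_mul_self.mp hK.nonneg
  refine ⟨fun c => WithLp.toLp 2 fun j => B j c, fun c c' => ?_⟩
  have := congrFun (congrFun hB c) c'
  simp only [Matrix.of_apply, Matrix.mul_apply, Matrix.star_eq_conjTranspose,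
    Matrix.conjTranspose_apply, star_trivial] at this
  rw [this]
  simp [PiLp.inner_apply, mul_comm]

/-- A ball in the RKHS, in terms of a feature map. -/
theorem InRKHSBall.exists_featureMap {C : Type} {K : C → C → ℝ} {B : ℝ} {f : C → ℝ}
    (h : InRKHSBall K B f) :
    ∃ (H : Type) (_ : NormedAddCommGroup H) (_ : InnerProductSpace ℝ H) (Φ : C → H) (g : H),
      (∀ c c', K c c' = inner ℝ (Φ c) (Φ c')) ∧ (∀ c, f c = inner ℝ (Φ c) g) ∧ ‖g‖ ≤ B := by
  obtain ⟨H, i1, i2, i3, i4, hK, g, hg, hB⟩ := h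
  refine ⟨H, i1, i2, fun c => RKHS.kerFun H c 1, g, fun c c' => ?_, fun c => ?_, hB⟩
  · rw [← hK, RKHS.kerFun_inner, RKHS.kerFun_apply]
    simp
  · rw [RKHS.kerFun_inner, hg]
    simp

/-! ### Runs of the algorithm: locality and measurability -/

section MatrixMeasurability

variable {Θ : Type*} [MeasurableSpace Θ]

theorem measurable_det {n : ℕ} {A : Θ → Matrix (Fin n) (Fin n) ℝ}
    (hA : ∀ i j, Measurable fun θ => A θ i j) : Measurable fun θ => (A θ).det := by
  simp only [Matrix.det_apply]
  exact Finset.measurable_fun_sum _ fun p _ =>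
    (Finset.measurable_fun_prod _ fun i _ => hA _ _).const_smul _

theorem measurable_matrix_inv {n : ℕ} {A : Θ → Matrix (Fin n) (Fin n) ℝ}
    (hA : ∀ i j, Measurable fun θ => A θ i j) (i j : Fin n) :
    Measurable fun θ => (A θ)⁻¹ i j := by
  simp only [Matrix.inv_def, Matrix.smul_apply, Ring.inverse_eq_inv', smul_eq_mul]
  refine (measurable_det hA).inv.mul ?_
  simp only [Matrix.adjugate_apply]
  refine measurable_det fun a b => ?_
  simp only [Matrix.updateRow_apply]
  split_ifs
  · exact measurable_const
  · exact hA a b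

variable {C : Type} {n : ℕ} {K : Θ → C → C → ℝ} (hK : Measurable K) (σ2 : ℝ) (X : Fin n → C)

include hK

theorem measurable_kernel_apply (a b : C) : Measurable fun θ => K θ a b :=
  (measurable_pi_apply b).comp ((measurable_pi_apply a).comp hK)

theorem measurable_regGram (i j : Fin n) : Measurable fun θ => regGram (K θ) σ2 X i j := by
  simp only [regGram, Matrix.add_apply, Matrix.of_apply]
  exact (measurable_kernel_apply hK _ _).add_const _

theorem measurable_postMean {y : Θ → Fin n → ℝ} (hy : Measurable y) (c : C) :
    Measurable fun θ => postMean (K θ) σ2 X (y θ) c := by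
  simp only [postMean, dotProduct, Matrix.mulVec]
  refine Finset.measurable_fun_sum _ fun i _ => (measurable_kernel_apply hK _ _).mul
    (Finset.measurable_fun_sum _ fun j _ => ?_)
  exact (measurable_matrix_inv (measurable_regGram hK σ2 X) i j).mul (by fun_prop)

theorem measurable_postStd (c : C) : Measurable fun θ => postStd (K θ) σ2 X c := by
  simp only [postStd, postVar, dotProduct, Matrix.mulVec]
  refine Measurable.sqrt ((measurable_kernel_apply hK _ _).sub
    (Finset.measurable_fun_sum _ fun i _ => (measurable_kernel_apply hK _ _).mul
    (Finset.measurable_fun_sum _ fun j _ => ?_)))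
  exact (measurable_matrix_inv (measurable_regGram hK σ2 X) i j).mul
    (measurable_kernel_apply hK _ _)

end MatrixMeasurability

/-- The algorithm uses the kernel only at embedded points, so it may be run on the combinatorial
space with the pulled back kernel. -/
theorem dataAfter_pullKernel {C E : Type} (k : E → E → ℝ) (σ2 : ℝ) (β : ℕ → ℝ) (φ : C → E)
    (argmin : (C → ℝ) → C) {n₀ : ℕ} (init : Fin n₀ → C) (f : C → ℝ) (η : ℕ → ℝ) (s : ℕ) :
    dataAfter k σ2 β φ argmin init f η s
      = dataAfter (pullKernel k φ) σ2 β (fun c => c) argmin init f η s := by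
  induction s with
  | zero => rfl
  | succ s ih =>
    rw [dataAfter, dataAfter, ih]
    rfl

theorem query_pullKernel {C E : Type} (k : E → E → ℝ) (σ2 : ℝ) (β : ℕ → ℝ) (φ : C → E)
    (argmin : (C → ℝ) → C) {n₀ : ℕ} (init : Fin n₀ → C) (f : C → ℝ) (η : ℕ → ℝ) (s : ℕ) :
    query k σ2 β φ argmin init f η s
      = query (pullKernel k φ) σ2 β (fun c => c) argmin init f η s := by
  rw [query, query, dataAfter_pullKernel]
  rfl

section Run

variable {C : Type} (K : C → C → ℝ) (σ2 : ℝ) (β : ℕ → ℝ) (argmin : (C → ℝ) → C)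
  {n₀ : ℕ} (init : Fin n₀ → C) (f : C → ℝ) (η : ℕ → ℝ)

/-- The run of the algorithm on the combinatorial space itself, with kernel `K`. -/
noncomputable abbrev run (s : ℕ) : Dataset C (n₀ + s) :=
  dataAfter K σ2 β (fun c => c) argmin init f η s

/-- The point at which the `i`-th observation is made, the initial design included. -/
noncomputable def arm (i : ℕ) : C :=
  if h : i < n₀ then init ⟨i, h⟩ else query K σ2 β (fun c => c) argmin init f η (i - n₀)

theorem arm_of_lt {i : ℕ} (h : i < n₀) : arm K σ2 β argmin init f η i = init ⟨i, h⟩ :=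
  dif_pos h

theorem arm_add (s : ℕ) :
    arm K σ2 β argmin init f η (n₀ + s) = query K σ2 β (fun c => c) argmin init f η s := by
  simp [arm]

theorem run_pts (s : ℕ) (i : Fin (n₀ + s)) :
    (run K σ2 β argmin init f η s).pts i = arm K σ2 β argmin init f η i := by
  induction s with
  | zero => exact (arm_of_lt K σ2 β argmin init f η i.2).symm
  | succ s ih =>
    refine Fin.lastCases ?_ (fun j => ?_) i
    · simp only [run, dataAfter]
      rw [Fin.snoc_last]
      exact (arm_add K σ2 β argmin init f η s).symm
    · simp only [run, dataAfter]
      rw [Fin.snoc_castSucc]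
      exact ih j

theorem run_obs (s : ℕ) (i : Fin (n₀ + s)) :
    (run K σ2 β argmin init f η s).obs i = f (arm K σ2 β argmin init f η i) + η i := by
  induction s with
  | zero => rw [arm_of_lt K σ2 β argmin init f η i.2]; rfl
  | succ s ih =>
    refine Fin.lastCases ?_ (fun j => ?_) i
    · simp only [run, dataAfter]
      rw [Fin.snoc_last]
      have := arm_add K σ2 β argmin init f η s
      rw [query] at this
      rw [← this]
      rfl
    · simp only [run, dataAfter]
      rw [Fin.snoc_castSucc]
      exact ih j

/-- The run only depends on the observed values: if another objective with other noise yields the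
same observations along the run, then the runs agree. -/
theorem run_congr {f' : C → ℝ} {η' : ℕ → ℝ} (s : ℕ)
    (h : ∀ i < n₀ + s, f (arm K σ2 β argmin init f η i) + η i
      = f' (arm K σ2 β argmin init f η i) + η' i) :
    run K σ2 β argmin init f η s = run K σ2 β argmin init f' η' s := by
  induction s with
  | zero =>
    simp only [run, dataAfter]
    congr 1
    ext i
    have := h i (by omega)
    rwa [arm_of_lt K σ2 β argmin init f η i.2] at this
  | succ s ih =>
    have ih' := ih fun i hi => h i (by omega)
    have h1 := h (n₀ + s) (by omega)
    rw [arm_add, query] at h1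
    simp only [run, dataAfter] at ih' ⊢
    rw [← ih', h1]

theorem arm_congr {f' : C → ℝ} {η' : ℕ → ℝ} (i : ℕ)
    (h : ∀ j < i, f (arm K σ2 β argmin init f η j) + η j
      = f' (arm K σ2 β argmin init f η j) + η' j) :
    arm K σ2 β argmin init f η i = arm K σ2 β argmin init f' η' i := by
  by_cases hi : i < n₀
  · rw [arm_of_lt _ _ _ _ _ _ _ hi, arm_of_lt _ _ _ _ _ _ _ hi]
  · obtain ⟨s, rfl⟩ := Nat.exists_eq_add_of_le (not_lt.mp hi)
    rw [arm_add, arm_add, query, query]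
    have := run_congr K σ2 β argmin init f η s h
    simp only [run] at this
    rw [this]

theorem arm_congr_noise {η η' : ℕ → ℝ} (i : ℕ) (h : ∀ j < i, η j = η' j) :
    arm K σ2 β argmin init f η i = arm K σ2 β argmin init f η' i :=
  arm_congr K σ2 β argmin init f η i fun j hj => by rw [h j hj]

end Run

section RunMeasurability

variable {Θ : Type*} [MeasurableSpace Θ] {C : Type} [Fintype C] [MeasurableSpace C]
  [MeasurableSingletonClass C] {K : Θ → C → C → ℝ} (hK : Measurable K) (σ2 : ℝ) (β : ℕ → ℝ)
  {argmin : (C → ℝ) → C} (hargmin : Measurable argmin) {n₀ : ℕ} (init : Fin n₀ → C)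
  {f : Θ → C → ℝ} (hf : Measurable f) {η : Θ → ℕ → ℝ} (hη : Measurable η)

omit [MeasurableSingletonClass C] [Fintype C] in
/-- Measurability in the presence of a measurable choice among countably many functions; it
reduces a random design to the fixed ones. -/
theorem measurable_of_countable_selector {ι β : Type*} [MeasurableSpace β] [MeasurableSpace ι]
    [Countable ι] [MeasurableSingletonClass ι] {X : Θ → ι} (hX : Measurable X) {F : ι → Θ → β}
    (hF : ∀ x, Measurable (F x)) : Measurable fun θ => F (X θ) θ :=
  (measurable_from_prod_countable_right (f := fun q : ι × Θ => F q.1 q.2) hF).comp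
    (hX.prodMk measurable_id)

include hK hargmin hf hη

theorem measurable_run (s : ℕ) :
    (Measurable fun θ => (run (K θ) σ2 β argmin init (f θ) (η θ) s).pts) ∧
    (Measurable fun θ => (run (K θ) σ2 β argmin init (f θ) (η θ) s).obs) := by
  induction s with
  | zero =>
    refine ⟨measurable_const, measurable_pi_lambda _ fun i => ?_⟩
    simp only [run, dataAfter]
    fun_prop
  | succ s ih =>
    obtain ⟨h1, h2⟩ := ih
    have hq : Measurable fun θ => nextQuery (K θ) σ2 (fun c => c) argmin (β (s + 1))
        (run (K θ) σ2 β argmin init (f θ) (η θ) s) := by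
      simp only [nextQuery]
      refine hargmin.comp (measurable_pi_lambda _ fun c => ?_)
      refine measurable_of_countable_selector h1 (F := fun X θ => ucb (K θ) σ2 (β (s + 1)) X
        (run (K θ) σ2 β argmin init (f θ) (η θ) s).obs c) fun X => ?_
      simp only [ucb]
      exact (measurable_postMean hK σ2 X h2 c).sub ((measurable_postStd hK σ2 X c).const_mul _)
    constructor
    · refine measurable_pi_lambda _ fun i => ?_
      refine Fin.lastCases ?_ (fun j => ?_) i
      · simp only [run, dataAfter, Fin.snoc_last]
        exact hq
      · simp only [run, dataAfter, Fin.snoc_castSucc]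
        exact (measurable_pi_apply j).comp h1
    · refine measurable_pi_lambda _ fun i => ?_
      refine Fin.lastCases ?_ (fun j => ?_) i
      · simp only [run, dataAfter, Fin.snoc_last]
        refine Measurable.add ?_ (by fun_prop)
        exact measurable_of_countable_selector hq (F := fun c θ => f θ c) fun c => by fun_prop
      · simp only [run, dataAfter, Fin.snoc_castSucc]
        exact (measurable_pi_apply j).comp h2

theorem measurable_arm (i : ℕ) :
    Measurable fun θ => arm (K θ) σ2 β argmin init (f θ) (η θ) i := by
  have h := (measurable_run hK σ2 β hargmin init hf hη (i + 1)).1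
  have := (measurable_pi_apply (⟨i, by omega⟩ : Fin (n₀ + (i + 1)))).comp h
  simpa only [Function.comp_def, run_pts] using this

end RunMeasurability

/-- The confidence bound of width `w` fails: at some iteration and some point, the posterior mean
is further away from the objective than `w` posterior standard deviations. -/
def BoundFails {C : Type} (σ2 : ℝ) (β w : ℕ → ℝ) (argmin : (C → ℝ) → C) {n₀ : ℕ}
    (init : Fin n₀ → C) (K : C → C → ℝ) (f : C → ℝ) (η : ℕ → ℝ) : Prop :=
  ∃ s c, w (s + 1) * postStd K σ2 (run K σ2 β argmin init f η s).pts c <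
    |f c - postMean K σ2 (run K σ2 β argmin init f η s).pts (run K σ2 β argmin init f η s).obs c|

theorem measurableSet_boundFails {Θ : Type*} [MeasurableSpace Θ] {C : Type} [Fintype C]
    [MeasurableSpace C] [MeasurableSingletonClass C] {K : Θ → C → C → ℝ} (hK : Measurable K)
    (σ2 : ℝ) (β w : ℕ → ℝ) {argmin : (C → ℝ) → C} (hargmin : Measurable argmin) {n₀ : ℕ}
    (init : Fin n₀ → C) {f : Θ → C → ℝ} (hf : Measurable f) {η : Θ → ℕ → ℝ} (hη : Measurable η) :
    MeasurableSet {θ | BoundFails σ2 β w argmin init (K θ) (f θ) (η θ)} := by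
  simp only [BoundFails, Set.ofPred_exists]
  refine MeasurableSet.iUnion fun s => MeasurableSet.iUnion fun c => ?_
  obtain ⟨h1, h2⟩ := measurable_run hK σ2 β hargmin init hf hη s
  refine measurableSet_lt (Measurable.const_mul ?_ _) (Measurable.abs (Measurable.sub
    (by fun_prop) ?_))
  · exact measurable_of_countable_selector h1 (F := fun X θ => postStd (K θ) σ2 X c) fun X =>
      measurable_postStd hK σ2 X c
  · exact measurable_of_countable_selector h1 (F := fun X θ => postMean (K θ) σ2 X
      (run (K θ) σ2 β argmin init (f θ) (η θ) s).obs c) fun X => measurable_postMean hK σ2 X h2 c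

/-! ### The confidence bound for an objective in the RKHS -/

section Width

variable {N : ℕ} (hN : 1 ≤ N) {δ : ℝ} (hδ : 0 < δ) (hδ1 : δ < 1)

theorem baseWidth_nonneg (N : ℕ) (δ : ℝ) (t : ℕ) : 0 ≤ baseWidth N δ t := Real.sqrt_nonneg _

include hN hδ

theorem baseWidth_arg_pos (t : ℕ) (ht : 1 ≤ t) :
    0 < (N : ℝ) * (t : ℝ) ^ 2 * Real.pi ^ 2 / (6 * δ) := by
  have : (0 : ℝ) < N := by exact_mod_cast hN
  have : (0 : ℝ) < t := by exact_mod_cast ht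
  positivity

theorem baseWidth_mono {t t' : ℕ} (ht : 1 ≤ t) (h : t ≤ t') :
    baseWidth N δ t ≤ baseWidth N δ t' := by
  have := baseWidth_arg_pos hN hδ t ht
  unfold baseWidth
  gcongr

include hδ1

theorem one_lt_baseWidth_arg (t : ℕ) (ht : 1 ≤ t) :
    1 < (N : ℝ) * (t : ℝ) ^ 2 * Real.pi ^ 2 / (6 * δ) := by
  have h1 : (1 : ℝ) ≤ N := by exact_mod_cast hN
  have h2 : (1 : ℝ) ≤ t := by exact_mod_cast ht
  have h3 : (9 : ℝ) < Real.pi ^ 2 := by nlinarith [Real.pi_gt_three]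
  rw [lt_div_iff₀ (by positivity)]
  have h4 : (1 : ℝ) ≤ N * (t : ℝ) ^ 2 := one_le_mul_of_one_le_of_one_le h1 (one_le_pow₀ h2)
  nlinarith

theorem exp_baseWidth (t : ℕ) (ht : 1 ≤ t) :
    Real.exp (-baseWidth N δ t ^ 2 / 2) = 6 * δ / (N * Real.pi ^ 2) * (1 / (t : ℝ) ^ 2) := by
  have h := one_lt_baseWidth_arg hN hδ hδ1 t ht
  have h1 : (N : ℝ) ≠ 0 := by positivity
  have h2 : (t : ℝ) ≠ 0 := by positivity
  rw [baseWidth, Real.sq_sqrt (mul_nonneg two_pos.le (Real.log_pos h).le), neg_div,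
    mul_div_cancel_left₀ _ two_ne_zero, Real.exp_neg, Real.exp_log (by linarith)]
  field_simp

/-- The widths are calibrated by `∑ 1 / t² = π² / 6`, so that the failure probabilities over all
`N` points and all iterations add up to `δ`. -/
theorem tsum_exp_baseWidth :
    ∑' j : ℕ, (N : ENNReal) * ENNReal.ofReal (Real.exp (-baseWidth N δ (j + 1) ^ 2 / 2))
      = ENNReal.ofReal δ := by
  have h1 : (N : ℝ) ≠ 0 := by positivity
  have hz : HasSum (fun j : ℕ => 1 / ((j + 1 : ℕ) : ℝ) ^ 2) (Real.pi ^ 2 / 6) := by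
    have := (hasSum_nat_add_iff (f := fun n : ℕ => 1 / (n : ℝ) ^ 2) 1
      (g := Real.pi ^ 2 / 6)).mpr (by simpa using hasSum_zeta_two)
    exact this
  have hs : HasSum (fun j : ℕ => (N : ℝ) * Real.exp (-baseWidth N δ (j + 1) ^ 2 / 2)) δ := by
    have := hz.mul_left ((N : ℝ) * (6 * δ / (N * Real.pi ^ 2)))
    have e : (N : ℝ) * (6 * δ / (N * Real.pi ^ 2)) * (Real.pi ^ 2 / 6) = δ := by
      field_simp
    rw [e] at this
    refine this.congr_fun fun j => ?_
    rw [exp_baseWidth hN hδ hδ1 (j + 1) (by omega), mul_assoc]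
  have ht := congrArg ENNReal.ofReal hs.tsum_eq
  rw [ENNReal.ofReal_tsum_of_nonneg (fun j => by positivity) hs.summable] at ht
  rw [← ht]
  refine tsum_congr fun j => ?_
  rw [ENNReal.ofReal_mul (Nat.cast_nonneg _), ENNReal.ofReal_natCast]

end Width

section ArmWise

variable {C : Type} [Fintype C] [DecidableEq C] {H : Type*} [NormedAddCommGroup H]
  [InnerProductSpace ℝ H] {Φ : C → H} {K : C → C → ℝ}
  (hK : ∀ c c', K c c' = inner ℝ (Φ c) (Φ c')) {σ2 : ℝ} (hσ : 0 < σ2)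

include hK hσ

/-- The noise part of the posterior mean. The weights agree on all observations of one point, so
only the `N` noise sums matter, one for each point; Cauchy-Schwarz over the points gives the
factor `√N`. -/
theorem abs_sum_weights_noise_le {n : ℕ} (X : Fin n → C) (c : C) (x : Fin n → ℝ) {b : ℝ}
    (hb : 0 ≤ b) (hx : ∀ a, |∑ i, if X i = a then x i else 0|
      ≤ b * Real.sqrt ((Finset.univ.filter fun i => X i = a).card * σ2)) :
    |∑ i, postWeights K σ2 X c i * x i|
      ≤ Real.sqrt (Fintype.card C) * b * postStd K σ2 X c := by
  set α := postWeights K σ2 X c with hα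
  set T : C → ℝ := fun a => ∑ i, if X i = a then α i ^ 2 else 0 with hT
  have hT0 : ∀ a, 0 ≤ T a := fun a => Finset.sum_nonneg fun i _ => by split_ifs <;> positivity
  have hTsum : ∑ a, T a = ∑ i, α i ^ 2 := by
    simp only [hT]
    rw [Finset.sum_comm]
    simp
  have hsplit : ∑ i, α i * x i = ∑ a, ∑ i, if X i = a then α i * x i else 0 := by
    rw [Finset.sum_comm]
    simp
  have hfib : ∀ a, |∑ i, if X i = a then α i * x i else 0| ≤ b * Real.sqrt (σ2 * T a) := by
    intro a
    by_cases h : ∃ i₀, X i₀ = a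
    · obtain ⟨i₀, hi₀⟩ := h
      have hα' : ∀ i, X i = a → α i = α i₀ := fun i hi =>
        postWeights_congr hK hσ X c (hi.trans hi₀.symm)
      have e1 : ∑ i, (if X i = a then α i * x i else 0)
          = α i₀ * ∑ i, if X i = a then x i else 0 := by
        rw [Finset.mul_sum]
        refine Finset.sum_congr rfl fun i _ => ?_
        split_ifs with hi
        · rw [hα' i hi]
        · simp
      have e2 : T a = (Finset.univ.filter fun i => X i = a).card * α i₀ ^ 2 := by
        simp only [hT]
        rw [← Finset.sum_filter, Finset.sum_congr rfl (g := fun _ => α i₀ ^ 2), Finset.sum_const,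
          nsmul_eq_mul]
        intro i hi
        rw [hα' i (Finset.mem_filter.mp hi).2]
      have e3 : σ2 * T a = (Finset.univ.filter fun i => X i = a).card * σ2 * α i₀ ^ 2 := by
        rw [e2]; ring
      rw [e1, abs_mul, e3, Real.sqrt_mul (by positivity), Real.sqrt_sq_eq_abs, mul_comm,
        ← mul_assoc]
      exact mul_le_mul_of_nonneg_right (hx a) (abs_nonneg _)
    · push Not at h
      have : ∑ i, (if X i = a then α i * x i else 0) = 0 :=
        Finset.sum_eq_zero fun i _ => if_neg (h i)
      rw [this, abs_zero]
      positivity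
  have hCS : ∑ a, Real.sqrt (σ2 * T a) ≤ Real.sqrt (Fintype.card C) * postStd K σ2 X c := by
    rw [postStd, ← Real.sqrt_mul (by positivity)]
    apply Real.le_sqrt_of_sq_le
    calc (∑ a, Real.sqrt (σ2 * T a)) ^ 2
        ≤ (Finset.univ : Finset C).card * ∑ a, Real.sqrt (σ2 * T a) ^ 2 := sq_sum_le_card_mul_sum_sq
      _ = Fintype.card C * (σ2 * ∑ i, α i ^ 2) := by
          rw [← hTsum, Finset.card_univ, Finset.mul_sum Finset.univ T]
          exact congrArg _ (Finset.sum_congr rfl fun a _ =>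
            Real.sq_sqrt (mul_nonneg hσ.le (hT0 a)))
      _ ≤ Fintype.card C * postVar K σ2 X c := by
          gcongr
          rw [postVar_eq hK hσ]
          linarith [sq_nonneg ‖Φ c - ∑ j, α j • Φ (X j)‖]
  calc |∑ i, α i * x i| ≤ ∑ a, |∑ i, if X i = a then α i * x i else 0| := by
        rw [hsplit]; exact Finset.abs_sum_le_sum_abs _ _
    _ ≤ ∑ a, b * Real.sqrt (σ2 * T a) := Finset.sum_le_sum fun a _ => hfib a
    _ = b * ∑ a, Real.sqrt (σ2 * T a) := by rw [Finset.mul_sum]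
    _ ≤ b * (Real.sqrt (Fintype.card C) * postStd K σ2 X c) := by gcongr
    _ = _ := by ring

omit [Fintype C] [DecidableEq C] in
/-- The bias of the posterior mean, for an objective in the RKHS. -/
theorem abs_bias_le {n : ℕ} (X : Fin n → C) (c : C) {f : C → ℝ} {g : H} {B : ℝ}
    (hf : ∀ c, f c = inner ℝ (Φ c) g) (hg : ‖g‖ ≤ B) :
    |f c - ∑ i, postWeights K σ2 X c i * f (X i)| ≤ B * postStd K σ2 X c := by
  set r := Φ c - ∑ j, postWeights K σ2 X c j • Φ (X j) with hr
  have h1 : f c - ∑ i, postWeights K σ2 X c i * f (X i) = inner ℝ r g := by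
    rw [hr, inner_sub_left, sum_inner]
    simp only [real_inner_smul_left, hf]
  have h2 : ‖r‖ ≤ postStd K σ2 X c := by
    apply Real.le_sqrt_of_sq_le
    rw [postVar_eq hK hσ, ← hr]
    have : 0 ≤ σ2 * ∑ j, postWeights K σ2 X c j ^ 2 := by positivity
    linarith
  rw [h1]
  calc |inner ℝ r g| ≤ ‖r‖ * ‖g‖ := abs_real_inner_le_norm _ _
    _ ≤ postStd K σ2 X c * B := mul_le_mul h2 hg (norm_nonneg _) (Real.sqrt_nonneg _)
    _ = _ := mul_comm _ _

variable [MeasurableSpace C] [MeasurableSingletonClass C]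

/-- The confidence bound for a fixed objective in the RKHS. The union bound runs over the points
`a` and the number `j` of observations of `a` after the initial design: since `j ≤ s` after `s`
iterations, the width at iteration `s + 1` is at least the one used for `j`. -/
theorem noiseLaw_boundFails_le [Nonempty C] {f : C → ℝ} {g : H} {B : ℝ}
    (hf : ∀ c, f c = inner ℝ (Φ c) g) (hg : ‖g‖ ≤ B) {δ : ℝ} (hδ : 0 < δ) (hδ1 : δ < 1)
    (β : ℕ → ℝ) {argmin : (C → ℝ) → C} (hargmin : Measurable argmin) {n₀ : ℕ} (init : Fin n₀ → C) :
    noiseLaw σ2.toNNReal {η | BoundFails σ2 β (fun t => B + Real.sqrt (Fintype.card C) *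
      baseWidth (Fintype.card C) δ t) argmin init K f η} ≤ ENNReal.ofReal δ := by
  have hN : 1 ≤ Fintype.card C := Fintype.card_pos
  set N := Fintype.card C with hNdef
  set p : C → ℕ → (ℕ → ℝ) → Prop := fun a i η => arm K σ2 β argmin init f η i = a with hp
  -- the number of observations of a point in the initial design, which does not depend on the noise
  set n0 : C → ℕ := fun a => Nat.count (fun j => ∃ h : j < n₀, init ⟨j, h⟩ = a) n₀ with hn0
  have hpred : ∀ a i, PredictableAt i (fun η => if p a i η then (1 : ℝ) else 0) := by
    intro a i
    constructor
    · refine Measurable.ite ?_ measurable_const measurable_const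
      exact (measurable_arm measurable_const σ2 β hargmin init measurable_const measurable_id i)
        (measurableSet_singleton a)
    · intro η η' h
      simp only [hp, arm_congr_noise K σ2 β argmin init f i h]
  have hcount0 : ∀ a η, Nat.count (fun j => p a j η) n₀ = n0 a := by
    intro a η
    simp only [hn0, Nat.count_eq_card_filter_range]
    congr 1
    refine Finset.filter_congr fun j hj => ?_
    have hj' := Finset.mem_range.mp hj
    simp only [hp, arm_of_lt K σ2 β argmin init f η hj', hj', exists_true_left]
  set bad : C → ℕ → Set (ℕ → ℝ) := fun a j => {η | ∃ i, Nat.count (fun l => p a l η) i = n0 a + j ∧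
    baseWidth N δ (j + 1) * Real.sqrt ((n0 a + j : ℕ) * (σ2.toNNReal : ℝ)) <
      |∑ l ∈ Finset.range i, if p a l η then η l else 0|} with hbad
  have hsub : {η | BoundFails σ2 β (fun t => B + Real.sqrt N * baseWidth N δ t) argmin init K f η}
      ⊆ ⋃ j, ⋃ a, bad a j := by
    intro η hη
    by_contra hno
    simp only [Set.mem_iUnion, not_exists] at hno
    obtain ⟨s, c, hsc⟩ := hη
    refine absurd hsc (not_lt.mpr ?_)
    set X := (run K σ2 β argmin init f η s).pts with hX
    have hXi : ∀ i, X i = arm K σ2 β argmin init f η i := run_pts K σ2 β argmin init f η s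
    have hnoise : ∀ a, |∑ i : Fin (n₀ + s), if X i = a then η i else 0|
        ≤ baseWidth N δ (s + 1) *
          Real.sqrt ((Finset.univ.filter fun i => X i = a).card * σ2) := by
      intro a
      obtain ⟨j, hj⟩ := Nat.exists_eq_add_of_le
        (Nat.count_monotone (fun l => p a l η) (show n₀ ≤ n₀ + s by omega))
      have hjs : j ≤ s := by
        have := Nat.count_add (fun l => p a l η) n₀ s
        have h2 := Nat.count_le (p := fun k => p a (n₀ + k) η) (n := s)
        omega
      rw [hcount0] at hj
      have hcard : (Finset.univ.filter fun i => X i = a).card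
          = Nat.count (fun l => p a l η) (n₀ + s) := by
        rw [Finset.card_filter, Nat.count_eq_card_filter_range, Finset.card_filter,
          ← Fin.sum_univ_eq_sum_range (fun l => if p a l η then 1 else 0)]
        exact Finset.sum_congr rfl fun i _ => by simp only [hXi, hp]
      have hsum : ∑ i : Fin (n₀ + s), (if X i = a then η i else 0)
          = ∑ l ∈ Finset.range (n₀ + s), if p a l η then η l else 0 := by
        rw [← Fin.sum_univ_eq_sum_range (fun l => if p a l η then η l else 0)]
        exact Finset.sum_congr rfl fun i _ => by simp only [hXi, hp]
      have h1 := hno j a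
      simp only [hbad, Set.mem_ofPred_eq, not_exists, not_and, not_lt] at h1
      have h2 := h1 (n₀ + s) hj
      rw [Real.coe_toNNReal _ hσ.le] at h2
      rw [hsum, hcard, hj]
      refine h2.trans ?_
      gcongr
      exact baseWidth_mono hN hδ (by omega) (by omega)
    have h1 := abs_bias_le hK hσ X c hf hg
    have h2 := abs_sum_weights_noise_le hK hσ X c (fun i => η i) (baseWidth_nonneg N δ (s + 1))
      hnoise
    rw [postMean_eq_sum hK]
    have h3 : f c - ∑ i, postWeights K σ2 X c i * (run K σ2 β argmin init f η s).obs i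
        = (f c - ∑ i, postWeights K σ2 X c i * f (X i)) - ∑ i, postWeights K σ2 X c i * η i := by
      rw [sub_sub, ← Finset.sum_add_distrib]
      congr 1
      refine Finset.sum_congr rfl fun i _ => ?_
      rw [run_obs, hXi]; ring
    rw [h3]
    calc _ ≤ _ := abs_sub _ _
      _ ≤ _ := add_le_add h1 h2
      _ = _ := by ring
  calc _ ≤ noiseLaw σ2.toNNReal (⋃ j, ⋃ a, bad a j) := measure_mono hsub
    _ ≤ ∑' j, ∑ a, noiseLaw σ2.toNNReal (bad a j) :=
        (measure_iUnion_le _).trans (ENNReal.tsum_le_tsum fun j => measure_iUnion_fintype_le _ _)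
    _ ≤ ∑' j : ℕ, (N : ENNReal) * ENNReal.ofReal (Real.exp (-baseWidth N δ (j + 1) ^ 2 / 2)) := by
        refine ENNReal.tsum_le_tsum fun j => ?_
        calc _ ≤ ∑ a : C, ENNReal.ofReal (Real.exp (-baseWidth N δ (j + 1) ^ 2 / 2)) :=
              Finset.sum_le_sum fun a _ => by
                have := selection_tail σ2.toNNReal (p a) (hpred a) (n0 a + j)
                  (baseWidth_nonneg N δ (j + 1))
                exact this
          _ = _ := by rw [Finset.sum_const, Finset.card_univ, nsmul_eq_mul]
    _ = ENNReal.ofReal δ := tsum_exp_baseWidth hN hδ hδ1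

end ArmWise

/-! ### The confidence bound for an objective drawn from the prior -/

theorem charFun_map_eq_integral {Ω E : Type*} [MeasurableSpace Ω] {μ : Measure Ω}
    [NormedAddCommGroup E] [InnerProductSpace ℝ E] [MeasurableSpace E] [OpensMeasurableSpace E]
    {X : Ω → E} (hX : Measurable X) (t : E) :
    charFun (μ.map X) t = ∫ ω, Complex.exp ((inner ℝ (X ω) t : ℝ) * Complex.I) ∂μ := by
  rw [charFun_apply, integral_map hX.aemeasurable]
  exact Continuous.aestronglyMeasurable (by fun_prop)

theorem integral_exp_noise (v : NNReal) (e : ℕ → ℝ) (n : ℕ) :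
    ∫ η, Complex.exp (((∑ i ∈ Finset.range n, e i * η i : ℝ) : ℂ) * Complex.I) ∂(noiseLaw v)
      = Complex.exp ((-(v * ∑ i ∈ Finset.range n, e i ^ 2) / 2 : ℝ) : ℂ) := by
  induction n with
  | zero => simp
  | succ n ih =>
    have hm : Measurable fun η : ℕ → ℝ => ∑ i ∈ Finset.range n, e i * η i := by fun_prop
    have hG : PredictableAt n fun η : ℕ → ℝ =>
        Complex.exp (((∑ i ∈ Finset.range n, e i * η i : ℝ) : ℂ) * Complex.I) := by
      constructor
      · exact ((Complex.measurable_ofReal.comp hm).mul_const _).cexp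
      · intro η η' h
        rw [Finset.sum_congr rfl fun i hi => by rw [h i (Finset.mem_range.mp hi)]]
    have he : PredictableAt n fun _ : ℕ → ℝ => e n := ⟨measurable_const, fun _ _ _ => rfl⟩
    have h := integral_predictable_mul_exp v hG he (B := 1)
      (fun η => (Complex.norm_exp_ofReal_mul_I _).le) 1
    rw [integral_mul_const, ih] at h
    have hl : ∀ η : ℕ → ℝ,
        Complex.exp (((∑ i ∈ Finset.range (n + 1), e i * η i : ℝ) : ℂ) * Complex.I)
        = Complex.exp (((∑ i ∈ Finset.range n, e i * η i : ℝ) : ℂ) * Complex.I)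
          * Complex.exp (((1 : ℝ) : ℂ) * (e n : ℂ) * η n * Complex.I) := by
      intro η
      rw [← Complex.exp_add, Finset.sum_range_succ]
      congr 1; push_cast; ring
    simp_rw [hl]
    rw [h, ← Complex.exp_add, Finset.sum_range_succ]
    congr 1; push_cast; ring

section GaussianProcess

variable {C : Type} [Fintype C] {H : Type*} [NormedAddCommGroup H]
  [InnerProductSpace ℝ H] {Φ : C → H} {K : C → C → ℝ}
  (hK : ∀ c c', K c c' = inner ℝ (Φ c) (Φ c')) {ν : Measure (C → ℝ)}

theorem IsGPLaw.isProbabilityMeasure (hν : IsGPLaw K ν) : IsProbabilityMeasure ν := by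
  have h := congrArg (fun m => m Set.univ) (hν 0)
  simp only [measure_univ] at h
  rw [Measure.map_apply (by fun_prop) MeasurableSet.univ] at h
  exact ⟨by simpa using h⟩

include hK in
/-- The characteristic function of finitely many (possibly repeated) values of a Gaussian process,
in terms of a feature map. -/
theorem IsGPLaw.integral_exp (hν : IsGPLaw K ν) {ι : Type*} [Fintype ι] (x : ι → C) (u : ι → ℝ) :
    ∫ f, Complex.exp (((∑ i, u i * f (x i) : ℝ) : ℂ) * Complex.I) ∂ν
      = Complex.exp ((-‖∑ i, u i • Φ (x i)‖ ^ 2 / 2 : ℝ) : ℂ) := by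
  classical
  set a : C → ℝ := fun c => ∑ i, if x i = c then u i else 0 with ha
  have h1 : ∀ f : C → ℝ, ∑ i, u i * f (x i) = ∑ c, a c * f c := by
    intro f
    simp only [ha, Finset.sum_mul, ite_mul, zero_mul]
    rw [Finset.sum_comm]
    simp
  have h2 : ∑ i, u i • Φ (x i) = ∑ c, a c • Φ c := by
    simp only [ha, Finset.sum_smul, ite_smul, zero_smul]
    rw [Finset.sum_comm]
    simp
  have h3 : ‖∑ c, a c • Φ c‖ ^ 2 = ∑ c, ∑ c', a c * a c' * K c c' := by
    rw [← real_inner_self_eq_norm_sq, sum_inner]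
    simp only [inner_sum, real_inner_smul_left, real_inner_smul_right, hK, mul_assoc]
    refine Finset.sum_congr rfl fun c _ => Finset.sum_congr rfl fun c' _ => ?_
    ring
  have h4 := charFun_gaussianReal (μ := 0) (v := (∑ c, ∑ c', a c * a c' * K c c').toNNReal) 1
  rw [← hν a, charFun_map_eq_integral (by fun_prop), Real.coe_toNNReal _ (h3 ▸ sq_nonneg _),
    ← h3] at h4
  simp_rw [h1]
  rw [h2]
  simp only [RCLike.inner_apply, conj_trivial, one_mul] at h4
  push_cast at h4 ⊢
  rw [h4]
  congr 1; ring

variable {σ2 : ℝ} (hσ : 0 < σ2) {n : ℕ} (X : Fin n → C) (c : C)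

/-- The error `f(c) - μ(c)` of the posterior mean, for a fixed design. -/
noncomputable def postError (K : C → C → ℝ) (σ2 : ℝ) (X : Fin n → C) (c : C)
    (q : (C → ℝ) × (ℕ → ℝ)) : ℝ :=
  q.1 c - ∑ i, postWeights K σ2 X c i * (q.1 (X i) + q.2 i)

/-- The observations at a fixed design. -/
noncomputable def observations (X : Fin n → C) (q : (C → ℝ) × (ℕ → ℝ)) : Fin n → ℝ :=
  fun i => q.1 (X i) + q.2 i

omit [Fintype C] in
theorem measurable_postError : Measurable (postError K σ2 X c) := by
  unfold postError
  fun_prop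

omit [Fintype C] in
theorem measurable_observations : Measurable (observations X) := by
  unfold observations
  fun_prop

include hK hσ

/-- The joint characteristic function of the posterior error and the observations has no mixed
term, by the normal equations for the weights. -/
theorem integral_exp_postError (hν : IsGPLaw K ν) (u : ℝ) (t : Fin n → ℝ) :
    ∫ q, Complex.exp (((u * postError K σ2 X c q + ∑ i, t i * observations X q i : ℝ) : ℂ)
        * Complex.I) ∂(ν.prod (noiseLaw σ2.toNNReal))
      = Complex.exp ((-(u ^ 2 * postVar K σ2 X c) / 2 : ℝ) : ℂ) *
        Complex.exp ((-(‖∑ i, t i • Φ (X i)‖ ^ 2 + σ2 * ∑ i, t i ^ 2) / 2 : ℝ) : ℂ) := by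
  have := hν.isProbabilityMeasure
  set α := postWeights K σ2 X c with hα
  -- coefficients of the noise and of the values of the process, the latter at `c` and at `X`
  set e : ℕ → ℝ := fun i => if h : i < n then t ⟨i, h⟩ - u * α ⟨i, h⟩ else 0 with he
  have he' : ∀ i : Fin n, e i = t i - u * α i := fun i => by simp [he]
  set x : Option (Fin n) → C := fun o => o.elim c X with hx
  set w : Option (Fin n) → ℝ := fun o => o.elim u (fun i => t i - u * α i) with hw
  have hsplit : ∀ q : (C → ℝ) × (ℕ → ℝ), Complex.exp (((u * postError K σ2 X c q
        + ∑ i, t i * observations X q i : ℝ) : ℂ) * Complex.I)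
      = Complex.exp (((∑ o, w o * q.1 (x o) : ℝ) : ℂ) * Complex.I)
        * Complex.exp (((∑ i ∈ Finset.range n, e i * q.2 i : ℝ) : ℂ) * Complex.I) := by
    intro q
    rw [← Complex.exp_add, ← add_mul, ← Complex.ofReal_add]
    congr 3
    rw [← Fin.sum_univ_eq_sum_range (fun i => e i * q.2 i), Fintype.sum_option]
    simp only [hx, hw, Option.elim_none, Option.elim_some, he', postError, observations, ← hα]
    rw [mul_sub, Finset.mul_sum, sub_add, ← Finset.sum_sub_distrib, add_assoc,
      ← Finset.sum_add_distrib, sub_eq_add_neg, ← Finset.sum_neg_distrib]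
    congr 1
    exact Finset.sum_congr rfl fun i _ => by ring
  simp_rw [hsplit]
  rw [integral_prod_mul (fun f : C → ℝ => Complex.exp (((∑ o, w o * f (x o) : ℝ) : ℂ) * Complex.I))
    (fun η : ℕ → ℝ => Complex.exp (((∑ i ∈ Finset.range n, e i * η i : ℝ) : ℂ) * Complex.I)),
    hν.integral_exp hK, integral_exp_noise, ← Complex.exp_add, ← Complex.exp_add,
    ← Complex.ofReal_add, ← Complex.ofReal_add]
  congr 2
  rw [← Fin.sum_univ_eq_sum_range (fun i => e i ^ 2), Real.coe_toNNReal _ hσ.le,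
    Fintype.sum_option, postVar_eq hK hσ]
  simp only [hx, hw, Option.elim_none, Option.elim_some, he', ← hα]
  set r := Φ c - ∑ j, α j • Φ (X j) with hr
  have h1 : u • Φ c + ∑ i, (t i - u * α i) • Φ (X i) = u • r + ∑ i, t i • Φ (X i) := by
    simp only [hr, sub_smul, smul_sub, Finset.sum_sub_distrib, mul_smul, ← Finset.smul_sum]
    abel
  have h2 : inner ℝ r (∑ i, t i • Φ (X i)) = σ2 * ∑ i, t i * α i := by
    rw [inner_sum, Finset.mul_sum]
    refine Finset.sum_congr rfl fun j _ => ?_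
    rw [real_inner_smul_right, real_inner_comm, hr, hα, inner_residual hK hσ]
    ring
  have h3 : ∑ i, (t i - u * α i) ^ 2
      = ∑ i, t i ^ 2 - 2 * u * ∑ i, t i * α i + u ^ 2 * ∑ i, α i ^ 2 := by
    rw [Finset.mul_sum, Finset.mul_sum, ← Finset.sum_sub_distrib, ← Finset.sum_add_distrib]
    exact Finset.sum_congr rfl fun i _ => by ring
  rw [h1, norm_add_sq_real, real_inner_smul_left, h2, h3, norm_smul, mul_pow, Real.norm_eq_abs,
    sq_abs]
  ring

theorem map_postError (hν : IsGPLaw K ν) :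
    (ν.prod (noiseLaw σ2.toNNReal)).map (postError K σ2 X c)
      = gaussianReal 0 (postVar K σ2 X c).toNNReal := by
  have := hν.isProbabilityMeasure
  have := Measure.isProbabilityMeasure_map (μ := ν.prod (noiseLaw σ2.toNNReal))
    (measurable_postError (K := K) (σ2 := σ2) X c).aemeasurable
  refine Measure.ext_of_charFun ?_
  ext u
  rw [charFun_gaussianReal, charFun_map_eq_integral (measurable_postError X c),
    Real.coe_toNNReal _ (postVar_nonneg hK hσ X c)]
  have h := integral_exp_postError hK hσ X c hν u 0
  simp only [Pi.zero_apply, zero_mul, Finset.sum_const_zero, add_zero, zero_smul, norm_zero] at h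
  simp only [RCLike.inner_apply, conj_trivial]
  push_cast at h ⊢
  rw [h, ← Complex.exp_add]
  congr 1
  simp
  ring

/-- For a fixed design, the posterior error is independent of the observations. -/
theorem indepFun_postError (hν : IsGPLaw K ν) :
    IndepFun (postError K σ2 X c) (observations X) (ν.prod (noiseLaw σ2.toNNReal)) := by
  have := hν.isProbabilityMeasure
  have hmE := measurable_postError (K := K) (σ2 := σ2) X c
  have hmY : Measurable fun q => (WithLp.toLp 2 (observations X q) : EuclideanSpace ℝ (Fin n)) :=
    (by fun_prop : Measurable fun y : Fin n → ℝ =>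
      (WithLp.toLp 2 y : EuclideanSpace ℝ (Fin n))).comp
      (measurable_observations X)
  have key : IndepFun (postError K σ2 X c)
      (fun q => (WithLp.toLp 2 (observations X q) : EuclideanSpace ℝ (Fin n)))
      (ν.prod (noiseLaw σ2.toNNReal)) := by
    rw [indepFun_iff_charFun_prod hmE.aemeasurable hmY.aemeasurable]
    intro ut
    obtain ⟨u, t⟩ := ut
    have hu := integral_exp_postError hK hσ X c hν u 0
    have ht := integral_exp_postError hK hσ X c hν 0 t
    have hut := integral_exp_postError hK hσ X c hν u t
    have hmEY : Measurable fun q => (WithLp.toLp 2 (postError K σ2 X c q,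
        (WithLp.toLp 2 (observations X q) : EuclideanSpace ℝ (Fin n))) :
          WithLp 2 (ℝ × EuclideanSpace ℝ (Fin n))) :=
      (by fun_prop : Measurable fun y : ℝ × EuclideanSpace ℝ (Fin n) =>
        WithLp.toLp 2 y).comp (hmE.prodMk hmY)
    rw [charFun_map_eq_integral hmE, charFun_map_eq_integral hmY, charFun_map_eq_integral hmEY]
    simp only [WithLp.prod_inner_apply, PiLp.inner_apply, RCLike.inner_apply, conj_trivial]
    simp only [Pi.zero_apply, zero_mul, Finset.sum_const_zero, add_zero, zero_smul, norm_zero,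
      zero_add, ne_eq, OfNat.ofNat_ne_zero, not_false_eq_true, zero_pow, mul_zero, neg_zero,
      zero_div, Complex.ofReal_zero, Complex.exp_zero, one_mul, mul_one] at hu ht
    rw [hu, ht, hut]
  exact key.comp (φ := id) (ψ := fun y : EuclideanSpace ℝ (Fin n) => y.ofLp) measurable_id
    (by fun_prop)

variable [MeasurableSpace C] [MeasurableSingletonClass C]

/-- The confidence bound for a Gaussian process. The design of the first `s` iterations takes
finitely many values `X`, and that it equals `X` is an event in terms of the observations at `X`,
hence independent of the posterior error for the design `X`. -/
theorem prod_boundFails_le [Nonempty C] (hν : IsGPLaw K ν)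
    {δ : ℝ} (hδ : 0 < δ) (hδ1 : δ < 1)
    (β : ℕ → ℝ) {argmin : (C → ℝ) → C} (hargmin : Measurable argmin) {n₀ : ℕ} (init : Fin n₀ → C) :
    (ν.prod (noiseLaw σ2.toNNReal)) {q | BoundFails σ2 β (baseWidth (Fintype.card C) δ)
      argmin init K q.1 q.2} ≤ ENNReal.ofReal δ := by
  have := hν.isProbabilityMeasure
  have hN : 1 ≤ Fintype.card C := Fintype.card_pos
  set N := Fintype.card C with hNdef
  set μ := ν.prod (noiseLaw σ2.toNNReal) with hμ
  set bad : ℕ → C → Set ((C → ℝ) × (ℕ → ℝ)) := fun s c => {q | baseWidth N δ (s + 1)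
    * postStd K σ2 (run K σ2 β argmin init q.1 q.2 s).pts c <
    |postError K σ2 (run K σ2 β argmin init q.1 q.2 s).pts c q|} with hbad
  have hpts : ∀ s, Measurable fun q : (C → ℝ) × (ℕ → ℝ) =>
      (run K σ2 β argmin init q.1 q.2 s).pts := fun s =>
    (measurable_run measurable_const σ2 β hargmin init measurable_fst measurable_snd s).1
  have hsub : {q : (C → ℝ) × (ℕ → ℝ) | BoundFails σ2 β (baseWidth N δ) argmin init K q.1 q.2}
      ⊆ ⋃ s, ⋃ c, bad s c := by
    rintro q ⟨s, c, h⟩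
    refine Set.mem_iUnion.mpr ⟨s, Set.mem_iUnion.mpr ⟨c, ?_⟩⟩
    rw [postMean_eq_sum hK] at h
    simp only [run_obs] at h
    simp only [hbad, Set.mem_ofPred_eq, postError, run_pts]
    exact h
  have hone : ∀ s c, μ (bad s c) ≤ ENNReal.ofReal (Real.exp (-baseWidth N δ (s + 1) ^ 2 / 2)) := by
    intro s c
    set E := ENNReal.ofReal (Real.exp (-baseWidth N δ (s + 1) ^ 2 / 2)) with hE
    set V : (Fin (n₀ + s) → C) → Set ((C → ℝ) × (ℕ → ℝ)) := fun X =>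
      (fun q : (C → ℝ) × (ℕ → ℝ) => (run K σ2 β argmin init q.1 q.2 s).pts) ⁻¹' {X} with hV
    have hX : ∀ X, μ (bad s c ∩ V X) ≤ E * μ (V X) := by
      intro X
      -- the event that `X` is the design is read off from the observations at `X` by replaying the
      -- run with objective `0` and these observations in place of the noise
      set ext : (Fin (n₀ + s) → ℝ) → ℕ → ℝ := fun y j => if h : j < n₀ + s then y ⟨j, h⟩ else 0
        with hext
      have hextm : Measurable ext := by
        refine measurable_pi_lambda _ fun j => ?_
        simp only [hext]
        split_ifs <;> fun_prop
      set Y : Set (Fin (n₀ + s) → ℝ) :=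
        (fun y => (run K σ2 β argmin init (fun _ => 0) (ext y) s).pts) ⁻¹' {X} with hY
      have hYm : MeasurableSet Y :=
        ((measurable_run measurable_const σ2 β hargmin init measurable_const hextm s).1)
          (measurableSet_singleton X)
      have hVY : V X = observations X ⁻¹' Y := by
        ext q
        simp only [hV, hY, Set.mem_preimage, Set.mem_singleton_iff]
        constructor
        · intro hq
          rw [← hq, ← run_congr K σ2 β argmin init q.1 q.2 s]
          intro i hi
          have := run_pts K σ2 β argmin init q.1 q.2 s ⟨i, hi⟩
          simp [hext, hi, observations, this]
        · intro hq
          rw [← hq, ← run_congr K σ2 β argmin init (fun _ => 0) (ext (observations X q)) s]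
          intro i hi
          have := run_pts K σ2 β argmin init (fun _ => 0) (ext (observations X q)) s ⟨i, hi⟩
          rw [hq] at this
          simp [hext, hi, observations, this]
      set A : Set ℝ := {x | baseWidth N δ (s + 1) * postStd K σ2 X c < |x|} with hA
      have hAm : MeasurableSet A := measurableSet_lt measurable_const (by fun_prop)
      have hsubX : bad s c ∩ V X ⊆ postError K σ2 X c ⁻¹' A ∩ observations X ⁻¹' Y := by
        rintro q ⟨hq, hqX⟩
        refine ⟨?_, hVY ▸ hqX⟩
        have hqX' : (run K σ2 β argmin init q.1 q.2 s).pts = X := hqX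
        simp only [hbad, Set.mem_ofPred_eq, hqX'] at hq
        exact hq
      have hA' : μ (postError K σ2 X c ⁻¹' A) ≤ E := by
        rw [← Measure.map_apply (measurable_postError X c) hAm, hμ, map_postError hK hσ X c hν]
        have := gaussianReal_abs_tail_le (postVar K σ2 X c).toNNReal
          (baseWidth_nonneg N δ (s + 1))
        rw [Real.coe_toNNReal _ (postVar_nonneg hK hσ X c)] at this
        exact this
      calc μ (bad s c ∩ V X) ≤ _ := measure_mono hsubX
        _ = μ (postError K σ2 X c ⁻¹' A) * μ (observations X ⁻¹' Y) :=
          (indepFun_postError hK hσ X c hν).measure_inter_preimage_eq_mul _ _ hAm hYm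
        _ ≤ E * μ (V X) := by rw [hVY]; gcongr
    have hcover : bad s c ⊆ ⋃ X, bad s c ∩ V X := fun q hq => Set.mem_iUnion.mpr ⟨_, hq, rfl⟩
    calc μ (bad s c) ≤ ∑ X, μ (bad s c ∩ V X) :=
          (measure_mono hcover).trans (measure_iUnion_fintype_le _ _)
      _ ≤ ∑ X, E * μ (V X) := Finset.sum_le_sum fun X _ => hX X
      _ = E * 1 := by
          rw [← Finset.mul_sum]
          congr 1
          have := sum_measure_preimage_singleton (μ := μ) Finset.univ
            (f := fun q : (C → ℝ) × (ℕ → ℝ) => (run K σ2 β argmin init q.1 q.2 s).pts)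
            (fun X _ => hpts s (measurableSet_singleton X))
          simp only [Finset.coe_univ, Set.preimage_univ, measure_univ] at this
          exact this
      _ = E := mul_one E
  calc _ ≤ μ (⋃ s, ⋃ c, bad s c) := measure_mono hsub
    _ ≤ ∑' s, ∑ c, μ (bad s c) :=
        (measure_iUnion_le _).trans (ENNReal.tsum_le_tsum fun j => measure_iUnion_fintype_le _ _)
    _ ≤ ∑' j : ℕ, (N : ENNReal) * ENNReal.ofReal (Real.exp (-baseWidth N δ (j + 1) ^ 2 / 2)) := by
        refine ENNReal.tsum_le_tsum fun j => ?_
        calc _ ≤ ∑ a : C, ENNReal.ofReal (Real.exp (-baseWidth N δ (j + 1) ^ 2 / 2)) :=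
              Finset.sum_le_sum fun c _ => hone j c
          _ = _ := by rw [Finset.sum_const, Finset.card_univ, nsmul_eq_mul]
    _ = ENNReal.ofReal δ := tsum_exp_baseWidth hN hδ hδ1

end GaussianProcess

/-! ### From the confidence bound to the regret -/

/-- The sum over time of a function of the number of previous visits, split over the points; `G` is
any discrete primitive from above. -/
theorem sum_visits_le {C : Type} [Fintype C] [DecidableEq C] (x : ℕ → C) {h G : ℕ → ℝ}
    (h0 : G 0 = 0) (hG : ∀ n, h n ≤ G (n + 1) - G n) (T : ℕ) :
    ∑ s ∈ Finset.range T, h (Nat.count (fun l => x l = x s) s)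
      ≤ ∑ a, G (Nat.count (fun l => x l = a) T) := by
  induction T with
  | zero => simp [h0]
  | succ T ih =>
    have : ∑ a, G (Nat.count (fun l => x l = a) (T + 1))
        = ∑ a, G (Nat.count (fun l => x l = a) T) + (G (Nat.count (fun l => x l = x T) T + 1)
          - G (Nat.count (fun l => x l = x T) T)) := by
      rw [← sub_eq_iff_eq_add', ← Finset.sum_sub_distrib, Finset.sum_eq_single (x T)]
      · rw [Nat.count_succ, if_pos rfl]
      · intro a _ ha
        rw [Nat.count_succ, if_neg (Ne.symm ha), add_zero, sub_self]
      · exact fun h => absurd (Finset.mem_univ _) h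
    rw [Finset.sum_range_succ, this]
    exact add_le_add ih (hG _)

theorem sum_count_eq {C : Type} [Fintype C] [DecidableEq C] (x : ℕ → C) (T : ℕ) :
    ∑ a, Nat.count (fun l => x l = a) T = T := by
  induction T with
  | zero => simp
  | succ T ih =>
    simp only [Nat.count_succ, Finset.sum_add_distrib, ih]
    simp

/-- If the standard deviation at a point is at most `κ` before its first visit and `σ / √m` after
`m` visits, then the standard deviations along `T` visits sum up to at most `D κ + 2 σ √(N T)`,
where `D` is the number of different visited points. -/
theorem sum_std_le {C : Type} [Fintype C] [DecidableEq C] (x : ℕ → C) {κ σ : ℝ}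
    (hσ : 0 ≤ σ) {u : ℕ → ℝ} (hu1 : ∀ s, u s ≤ κ)
    (hu2 : ∀ s, 0 < Nat.count (fun l => x l = x s) s →
      u s ≤ σ / Real.sqrt (Nat.count (fun l => x l = x s) s)) (T : ℕ) :
    ∃ D : ℝ, 0 ≤ D ∧ D ≤ Fintype.card C ∧ D ≤ T ∧
      ∑ s ∈ Finset.range T, u s ≤ D * κ + 2 * σ * Real.sqrt (Fintype.card C * T) := by
  set cnt : C → ℕ := fun a => Nat.count (fun l => x l = a) T with hcnt
  set h : ℕ → ℝ := fun n => if n = 0 then κ else σ / Real.sqrt n with hh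
  -- `1 / √m ≤ 2 (√m - √(m - 1))` makes `2 √(n - 1)` a primitive from above; at `n = 0` the
  -- truncated subtraction gives `0`
  set G : ℕ → ℝ := fun n => (if n = 0 then 0 else 1) * κ + 2 * σ * Real.sqrt ((n - 1 : ℕ) : ℝ)
    with hG
  have hstep : ∀ n, h n ≤ G (n + 1) - G n := by
    intro n
    rcases Nat.eq_zero_or_pos n with rfl | hn
    · simp [hh, hG]
    · obtain ⟨m, rfl⟩ : ∃ m, n = m + 1 := ⟨n - 1, by omega⟩
      simp only [hh, hG, Nat.add_one_ne_zero, if_false, one_mul, Nat.add_sub_cancel]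
      set a := Real.sqrt ((m + 1 : ℕ) : ℝ) with ha
      set b := Real.sqrt (m : ℝ) with hb
      have ha2 : a ^ 2 = m + 1 := by rw [ha, Real.sq_sqrt (by positivity)]; push_cast; ring
      have hb2 : b ^ 2 = m := Real.sq_sqrt (by positivity)
      have ha0 : 0 < a := Real.sqrt_pos.mpr (by positivity)
      have : 1 ≤ 2 * (a - b) * a := by nlinarith [sq_nonneg (a - b)]
      rw [div_le_iff₀ ha0]
      nlinarith
  have h1 : ∑ s ∈ Finset.range T, u s ≤ ∑ a, G (cnt a) := by
    refine le_trans (Finset.sum_le_sum fun s _ => ?_)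
      (sum_visits_le x (h := h) (G := G) (by simp [hG]) hstep T)
    simp only [hh]
    split_ifs with h0
    · exact hu1 s
    · exact hu2 s (Nat.pos_of_ne_zero h0)
  have hsumcnt : ∑ a, (cnt a : ℝ) = T := by exact_mod_cast sum_count_eq x T
  have h2 : ∑ a, Real.sqrt (cnt a : ℝ) ≤ Real.sqrt (Fintype.card C * T) := by
    apply Real.le_sqrt_of_sq_le
    refine sq_sum_le_card_mul_sum_sq.trans (le_of_eq ?_)
    rw [Finset.card_univ, ← hsumcnt]
    simp only [Real.sq_sqrt (Nat.cast_nonneg _)]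
  refine ⟨∑ a, if cnt a = 0 then 0 else 1, Finset.sum_nonneg fun a _ => by split_ifs <;> norm_num,
    ?_, ?_, h1.trans ?_⟩
  · calc ∑ a, (if cnt a = 0 then (0 : ℝ) else 1) ≤ ∑ a : C, (1 : ℝ) :=
          Finset.sum_le_sum fun a _ => by split_ifs <;> norm_num
      _ = Fintype.card C := by simp
  · rw [← hsumcnt]
    refine Finset.sum_le_sum fun a _ => ?_
    split_ifs with h0
    · exact Nat.cast_nonneg _
    · exact_mod_cast Nat.pos_of_ne_zero h0
  · simp only [hG]
    rw [Finset.sum_add_distrib, ← Finset.sum_mul, ← Finset.mul_sum]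
    have h3 : ∑ a, Real.sqrt ((cnt a - 1 : ℕ) : ℝ) ≤ ∑ a, Real.sqrt (cnt a : ℝ) :=
      Finset.sum_le_sum fun a _ => Real.sqrt_le_sqrt (by exact_mod_cast Nat.sub_le _ _)
    have h4 := h3.trans h2
    gcongr

theorem one_lt_div_of_nat {N T : ℕ} (hN : 1 ≤ N) (hT : 1 ≤ T) {δ : ℝ} (hδ : 0 < δ) (hδ1 : δ < 1) :
    1 < (N : ℝ) * T / δ := by
  have h1 : (1 : ℝ) ≤ N := by exact_mod_cast hN
  have h2 : (1 : ℝ) ≤ T := by exact_mod_cast hT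
  rw [lt_div_iff₀ hδ]
  nlinarith [one_le_mul_of_one_le_of_one_le h1 h2]

theorem tendsto_log_div {N : ℕ} (hN : 1 ≤ N) {δ : ℝ} (hδ : 0 < δ) :
    Tendsto (fun T : ℕ => Real.log ((N : ℝ) * T / δ) / T) atTop (𝓝 0) := by
  have h1 : Tendsto (fun T : ℕ => Real.log (T : ℝ) / (T : ℝ)) atTop (𝓝 0) :=
    (Real.isLittleO_log_id_atTop.tendsto_div_nhds_zero).comp tendsto_natCast_atTop_atTop
  have h2 := (tendsto_const_div_atTop_nhds_zero_nat (Real.log ((N : ℝ) / δ))).add h1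
  rw [add_zero] at h2
  refine h2.congr' ?_
  filter_upwards [eventually_ge_atTop 1] with T hT
  have hN' : (0 : ℝ) < N := by exact_mod_cast hN
  have hT' : (0 : ℝ) < T := by exact_mod_cast hT
  rw [← add_div, ← Real.log_mul (by positivity) hT'.ne']
  congr 2
  ring

/-- The passage from the sum of the standard deviations to the regret rates. Both
`D ≤ √(N T)` and, for large `T`, `D √kmax ≤ √((σ² + ε²) N T)` follow from `D ≤ min N T`. -/
theorem regretBound_of_le {A kmax σ ε δ : ℝ} {N : ℕ} {Reg : ℕ → ℝ} (hA : 0 ≤ A) (hk : 0 ≤ kmax)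
    (hσ : 0 < σ) (hδ : 0 < δ) (hδ1 : δ < 1) (hN : 1 ≤ N) (h0 : ∀ T, 0 ≤ Reg T)
    (hReg : ∀ T : ℕ, 1 ≤ T → ∃ D : ℝ, 0 ≤ D ∧ D ≤ N ∧ D ≤ T ∧
      Reg T ≤ 2 * (A * Real.sqrt (Real.log ((N : ℝ) * T / δ))) *
        (D * Real.sqrt kmax + 2 * σ * Real.sqrt (N * T))) :
    RegretBound (6 * A) kmax σ ε δ N Reg := by
  set v := σ ^ 2 + ε ^ 2 with hv
  have hvpos : 0 < v := by positivity
  set sv := Real.sqrt v with hsv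
  have hsv0 : 0 < sv := Real.sqrt_pos.mpr hvpos
  have hσv : σ ≤ sv := Real.le_sqrt_of_sq_le (by rw [hv]; nlinarith [sq_nonneg ε])
  have hrate : ∀ T : ℕ, regretRate σ ε δ N T
      = sv * Real.sqrt (N * T) * Real.sqrt (Real.log ((N : ℝ) * T / δ)) := by
    intro T
    rw [regretRate, ← hv, mul_assoc v, Real.sqrt_mul (by positivity), Real.sqrt_mul (by positivity)]
  have hfirst : ∀ T : ℕ, 1 ≤ T →
      Reg T ≤ 6 * A * (1 + Real.sqrt (kmax / v)) * regretRate σ ε δ N T := by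
    intro T hT
    obtain ⟨D, hD0, hDN, hDT, h⟩ := hReg T hT
    set L := Real.sqrt (Real.log ((N : ℝ) * T / δ)) with hL
    set Q := Real.sqrt ((N : ℝ) * T) with hQ
    have hL0 : 0 ≤ L := Real.sqrt_nonneg _
    have hQ0 : 0 ≤ Q := Real.sqrt_nonneg _
    have hDQ : D ≤ Q := Real.le_sqrt_of_sq_le (by
      rw [sq]; exact mul_le_mul hDN hDT hD0 (by positivity))
    have hκ : Real.sqrt (kmax / v) * sv = Real.sqrt kmax := by
      rw [Real.sqrt_div hk, div_mul_cancel₀ _ hsv0.ne']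
    have hκ0 := Real.sqrt_nonneg kmax
    calc Reg T ≤ _ := h
      _ ≤ 2 * (A * L) * (Q * Real.sqrt kmax + 2 * sv * Q) := by gcongr
      _ ≤ 2 * (A * L) * (3 * (Q * Real.sqrt kmax + sv * Q)) := by
          gcongr
          nlinarith [mul_nonneg hQ0 hκ0, mul_nonneg hsv0.le hQ0]
      _ = 6 * A * (1 + Real.sqrt (kmax / v)) * regretRate σ ε δ N T := by
          rw [hrate, ← hκ]; ring
  refine ⟨hfirst, ?_, ?_⟩
  · intro T hT hTk
    obtain ⟨D, hD0, hDN, hDT, h⟩ := hReg T hT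
    set L := Real.sqrt (Real.log ((N : ℝ) * T / δ)) with hL
    set Q := Real.sqrt ((N : ℝ) * T) with hQ
    have hL0 : 0 ≤ L := Real.sqrt_nonneg _
    have hDk : D * Real.sqrt kmax ≤ sv * Q := by
      calc D * Real.sqrt kmax ≤ N * Real.sqrt kmax := by gcongr
        _ ≤ sv * Q := by
          rw [hsv, hQ, ← Real.sqrt_mul hvpos.le]
          apply Real.le_sqrt_of_sq_le
          rw [mul_pow, Real.sq_sqrt hk]
          rw [← hv, div_le_iff₀ hvpos] at hTk
          have hN' : (0 : ℝ) ≤ N := Nat.cast_nonneg N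
          nlinarith
    calc Reg T ≤ _ := h
      _ ≤ 2 * (A * L) * (sv * Q + 2 * sv * Q) := by gcongr
      _ = 6 * A * regretRate σ ε δ N T := by rw [hrate]; ring
  · have hlim : Tendsto (fun T : ℕ => 6 * A * (1 + Real.sqrt (kmax / v)) * (sv * Real.sqrt N) *
        Real.sqrt (Real.log ((N : ℝ) * T / δ) / T)) atTop (𝓝 0) := by
      have := ((tendsto_log_div hN hδ).sqrt).const_mul
        (6 * A * (1 + Real.sqrt (kmax / v)) * (sv * Real.sqrt N))
      simpa using this
    refine tendsto_of_tendsto_of_tendsto_of_le_of_le' tendsto_const_nhds hlim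
      (Eventually.of_forall fun T => div_nonneg (h0 T) (Nat.cast_nonneg T)) ?_
    filter_upwards [eventually_ge_atTop 1] with T hT
    have hT' : (0 : ℝ) < T := by exact_mod_cast hT
    rw [div_le_iff₀ hT']
    refine (hfirst T hT).trans (le_of_eq ?_)
    rw [hrate, Real.sqrt_mul (by positivity),
      Real.sqrt_div (Real.log_pos (one_lt_div_of_nat hN hT hδ hδ1)).le]
    have : Real.sqrt T * Real.sqrt T = T := Real.mul_self_sqrt hT'.le
    field_simp
    rw [sq, this]

/-- As long as the confidence bound holds, the regret of an iteration is at most twice the width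
times the standard deviation at the queried point, and the regret bound follows. -/
theorem regretBound_of_not_boundFails {C : Type} [Fintype C] [DecidableEq C] [Nonempty C]
    {H : Type*} [NormedAddCommGroup H] [InnerProductSpace ℝ H] {Φ : C → H} {K : C → C → ℝ}
    (hK : ∀ c c', K c c' = inner ℝ (Φ c) (Φ c')) {kmax : ℝ} (hkmax : ∀ c, K c c ≤ kmax)
    {A ε σ δ : ℝ} (hσ : 0 < σ) (hδ : 0 < δ) (hδ1 : δ < 1) {β w : ℕ → ℝ}
    (hβ : ∀ t : ℕ, 1 ≤ t → β t ≤ A * Real.sqrt (Real.log ((Fintype.card C : ℝ) * t / δ)))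
    (hw0 : 0 ≤ w 1) (hw : ∀ t, 1 ≤ t → w t ≤ β t)
    {argmin : (C → ℝ) → C} (hargmin : ∀ (g : C → ℝ) (c : C), g (argmin g) ≤ g c)
    {n₀ : ℕ} (init : Fin n₀ → C) {f : C → ℝ} {η : ℕ → ℝ}
    (h : ¬ BoundFails (σ ^ 2) β w argmin init K f η) :
    RegretBound (6 * A) kmax σ ε δ (Fintype.card C)
      (cumRegret K (σ ^ 2) β (fun c => c) argmin init f η) := by
  have hσ2 : 0 < σ ^ 2 := by positivity
  have hN : 1 ≤ Fintype.card C := Fintype.card_pos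
  set N := Fintype.card C with hNdef
  have hlog : ∀ t : ℕ, 1 ≤ t → 0 < Real.log ((N : ℝ) * t / δ) := fun t ht =>
    Real.log_pos (one_lt_div_of_nat hN ht hδ hδ1)
  -- `A ≥ 0` is forced by the nonnegative width of the first iteration, as `log (N / δ) > 0`
  have hA : 0 ≤ A := by
    have h1 := (hw0.trans (hw 1 le_rfl)).trans (hβ 1 le_rfl)
    exact nonneg_of_mul_nonneg_left h1 (Real.sqrt_pos.mpr (hlog 1 le_rfl))
  have hk : 0 ≤ kmax := by
    obtain ⟨c⟩ := ‹Nonempty C›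
    refine le_trans ?_ (hkmax c)
    rw [hK]; exact real_inner_self_nonneg
  set x : ℕ → C := fun s => query K (σ ^ 2) β (fun c => c) argmin init f η s with hx
  set X : (s : ℕ) → Fin (n₀ + s) → C := fun s => (run K (σ ^ 2) β argmin init f η s).pts with hX
  set u : ℕ → ℝ := fun s => postStd K (σ ^ 2) (X s) (x s) with hu
  have hinst0 : ∀ s, 0 ≤ f (x s) - ⨅ c, f c := fun s =>
    sub_nonneg.mpr (ciInf_le (Set.finite_range f).bddBelow _)
  have hinst : ∀ s, f (x s) - ⨅ c, f c ≤ 2 * β (s + 1) * u s := by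
    intro s
    obtain ⟨c, hc⟩ := exists_eq_ciInf_of_finite (f := f)
    simp only [BoundFails, not_exists, not_lt] at h
    have h1 := (abs_le.mp (h s (x s))).2
    have h2 := (abs_le.mp (h s c)).1
    have h3 := hargmin (fun c => ucb K (σ ^ 2) (β (s + 1)) (X s)
      (run K (σ ^ 2) β argmin init f η s).obs c) c
    have h4 : argmin (fun c => ucb K (σ ^ 2) (β (s + 1)) (X s)
      (run K (σ ^ 2) β argmin init f η s).obs c) = x s := rfl
    rw [h4] at h3
    simp only [ucb] at h3
    have h5 := mul_le_mul_of_nonneg_right (hw (s + 1) (by omega))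
      (Real.sqrt_nonneg (postVar K (σ ^ 2) (X s) (x s)))
    have h6 := mul_le_mul_of_nonneg_right (hw (s + 1) (by omega))
      (Real.sqrt_nonneg (postVar K (σ ^ 2) (X s) c))
    rw [← hc]
    simp only [hu, postStd] at *
    linarith
  have hu1 : ∀ s, u s ≤ Real.sqrt kmax := fun s =>
    Real.sqrt_le_sqrt ((postVar_le_prior hK hσ2 _ _).trans (hkmax _))
  have hu2 : ∀ s, 0 < Nat.count (fun l => x l = x s) s →
      u s ≤ σ / Real.sqrt (Nat.count (fun l => x l = x s) s) := by
    intro s hs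
    have hcount : Nat.count (fun l => x l = x s) s
        ≤ (Finset.univ.filter fun i => X s i = x s).card := by
      have e1 : (Finset.univ.filter fun i => X s i = x s).card
          = Nat.count (fun l => arm K (σ ^ 2) β argmin init f η l = x s) (n₀ + s) := by
        rw [Finset.card_filter, Nat.count_eq_card_filter_range, Finset.card_filter,
          ← Fin.sum_univ_eq_sum_range
            (fun l => if arm K (σ ^ 2) β argmin init f η l = x s then 1 else 0)]
        exact Finset.sum_congr rfl fun i _ => by simp only [hX, run_pts]
      rw [e1, Nat.count_add]
      simp only [arm_add]
      exact Nat.le_add_left _ _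
    have hcount' : ((Nat.count (fun l => x l = x s) s : ℕ) : ℝ)
        ≤ (Finset.univ.filter fun i => X s i = x s).card := by exact_mod_cast hcount
    have hs' : (0 : ℝ) < Nat.count (fun l => x l = x s) s := by exact_mod_cast hs
    have h1 := postVar_le_div hK hσ2 (X s) (x s) (hs.trans_le hcount)
    calc u s ≤ Real.sqrt (σ ^ 2 / Nat.count (fun l => x l = x s) s) := by
          apply Real.sqrt_le_sqrt
          refine h1.trans ?_
          gcongr
      _ = _ := by rw [Real.sqrt_div (sq_nonneg σ), Real.sqrt_sq hσ.le]
  refine regretBound_of_le hA hk hσ hδ hδ1 hN (fun T => Finset.sum_nonneg fun s _ => hinst0 s) ?_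
  intro T hT
  obtain ⟨D, hD0, hDN, hDT, hD⟩ := sum_std_le x hσ.le hu1 hu2 T
  refine ⟨D, hD0, hDN, hDT, ?_⟩
  calc cumRegret K (σ ^ 2) β (fun c => c) argmin init f η T
      ≤ ∑ s ∈ Finset.range T, 2 * (A * Real.sqrt (Real.log ((N : ℝ) * T / δ))) * u s := by
        refine Finset.sum_le_sum fun s hs => (hinst s).trans ?_
        have hsT : s + 1 ≤ T := Finset.mem_range.mp hs
        have hsT' : ((s + 1 : ℕ) : ℝ) ≤ T := by exact_mod_cast hsT
        have hN' : (0 : ℝ) < N := by exact_mod_cast hN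
        have h1 : β (s + 1) ≤ A * Real.sqrt (Real.log ((N : ℝ) * T / δ)) := by
          refine (hβ (s + 1) (by omega)).trans ?_
          gcongr
        have hu0 : 0 ≤ u s := Real.sqrt_nonneg _
        gcongr
    _ = 2 * (A * Real.sqrt (Real.log ((N : ℝ) * T / δ))) * ∑ s ∈ Finset.range T, u s := by
        rw [Finset.mul_sum]
    _ ≤ _ := by gcongr

/-! ### Randomness of the embedding and the objective -/

theorem cumRegret_pullKernel {C E : Type} (k : E → E → ℝ) (σ2 : ℝ) (β : ℕ → ℝ) (φ : C → E)
    (argmin : (C → ℝ) → C) {n₀ : ℕ} (init : Fin n₀ → C) (f : C → ℝ) (η : ℕ → ℝ) :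
    cumRegret k σ2 β φ argmin init f η
      = cumRegret (pullKernel k φ) σ2 β (fun c => c) argmin init f η := by
  ext T
  simp only [cumRegret, query_pullKernel k]

theorem measurable_embed {d m : ℕ} (b : Fin m → Bool) :
    Measurable fun R : Fin d → Fin m → ℝ => embed R b := by
  have h : Measurable fun R : Fin d → Fin m → ℝ => Matrix.of R *ᵥ boolVec b := by
    refine measurable_pi_lambda _ fun i => ?_
    simp only [Matrix.mulVec, dotProduct, Matrix.of_apply]
    fun_prop
  exact (by fun_prop : Measurable fun y : Fin d → ℝ =>
    (WithLp.toLp 2 y : EuclideanSpace ℝ (Fin d))).comp h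

theorem measurable_pullKernel_embed {C : Type} [Countable C] {d m : ℕ} (code : C → Fin m → Bool)
    {k : EuclideanSpace ℝ (Fin d) → EuclideanSpace ℝ (Fin d) → ℝ}
    (hk : Measurable (Function.uncurry k)) :
    Measurable fun R : Fin d → Fin m → ℝ => pullKernel k fun c => embed R (code c) :=
  measurable_pi_lambda _ fun c => measurable_pi_lambda _ fun c' =>
    hk.comp ((measurable_embed (code c)).prodMk (measurable_embed (code c')))

theorem measurableSet_lowDistortion {C : Type} [Countable C] {d m : ℕ} (code : C → Fin m → Bool)
    (ε : ℝ) : MeasurableSet {R : Fin d → Fin m → ℝ | LowDistortion code ε R} := by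
  have h : ∀ c c', Measurable fun R : Fin d → Fin m → ℝ =>
      ‖embed R (code c) - embed R (code c')‖ ^ 2 := fun c c' =>
    ((measurable_embed (code c)).sub (measurable_embed (code c'))).norm.pow_const 2
  simp only [LowDistortion, Set.ofPred_forall, Set.ofPred_and]
  exact MeasurableSet.iInter fun c => MeasurableSet.iInter fun c' =>
    (measurableSet_le measurable_const (h c c')).inter (measurableSet_le (h c c') measurable_const)

/-- A bound on the conditional probability of the complement of `S`; `S` need not be measurable. -/
theorem one_sub_le_cond_real {Ω : Type*} [MeasurableSpace Ω] {P : Measure Ω}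
    [IsProbabilityMeasure P] {E S bad : Set Ω} (hE : MeasurableSet E) (hE0 : P E ≠ 0)
    (hS : ∀ ω ∈ E, ω ∉ bad → ω ∈ S)
    {δ : ℝ} (hδ : 0 ≤ δ) (hbad : P (E ∩ bad) ≤ ENNReal.ofReal δ * P E) :
    1 - δ ≤ (ProbabilityTheory.cond P E).real S := by
  have := cond_isProbabilityMeasure (μ := P) hE0
  have h1 : (ProbabilityTheory.cond P E) Sᶜ ≤ ENNReal.ofReal δ := by
    rw [cond_apply hE]
    have hsub : E ∩ Sᶜ ⊆ E ∩ bad := fun ω hω =>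
      ⟨hω.1, by_contra fun hb => hω.2 (hS ω hω.1 hb)⟩
    calc (P E)⁻¹ * P (E ∩ Sᶜ) ≤ (P E)⁻¹ * (ENNReal.ofReal δ * P E) := by
          gcongr
          exact (measure_mono hsub).trans hbad
      _ = ENNReal.ofReal δ := by
          rw [mul_comm, mul_assoc, ENNReal.mul_inv_cancel hE0 (measure_ne_top P E), mul_one]
  have h2 : (ProbabilityTheory.cond P E).real Sᶜ ≤ δ := by
    rw [measureReal_def]
    exact ENNReal.toReal_le_of_le_ofReal hδ h1
  have h3 : 1 ≤ (ProbabilityTheory.cond P E).real S + (ProbabilityTheory.cond P E).real Sᶜ := by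
    have := measureReal_union_le (μ := ProbabilityTheory.cond P E) S Sᶜ
    rwa [Set.union_compl_self, probReal_univ] at this
  linarith

section Disintegration

variable {Ω 𝓡 𝓕 : Type*} [MeasurableSpace Ω] [MeasurableSpace 𝓡] [MeasurableSpace 𝓕]
  {P : Measure Ω} [IsProbabilityMeasure P] {R : Ω → 𝓡} {F : Ω → 𝓕} {η : Ω → ℕ → ℝ}
  (hR : Measurable R) (hF : Measurable F) (hη : Measurable η)
  (hind : IndepFun (fun ω => (R ω, F ω)) η P) {E : Set 𝓡} (hE : MeasurableSet E)
  {bad : 𝓡 → 𝓕 → (ℕ → ℝ) → Prop}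
  (hbad : MeasurableSet {q : (𝓡 × 𝓕) × (ℕ → ℝ) | bad q.1.1 q.1.2 q.2})
  {δ : ENNReal}

include hE hbad in
omit [MeasurableSpace Ω] in
theorem measurable_indicator_measure_bad {μ : Measure (ℕ → ℝ)} [SFinite μ] :
    Measurable fun rf : 𝓡 × 𝓕 => E.indicator (fun _ => μ {y | bad rf.1 rf.2 y}) rf.1 := by
  have h1 : Measurable fun rf : 𝓡 × 𝓕 => μ {y | bad rf.1 rf.2 y} :=
    measurable_measure_prodMk_left hbad
  have h2 : (fun rf : 𝓡 × 𝓕 => E.indicator (fun _ => μ {y | bad rf.1 rf.2 y}) rf.1)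
      = (Prod.fst ⁻¹' E).indicator fun rf : 𝓡 × 𝓕 => μ {y | bad rf.1 rf.2 y} := by
    ext rf
    by_cases hr : rf.1 ∈ E <;> simp [hr]
  rw [h2]
  exact h1.indicator (hE.preimage measurable_fst)

include hR hF hη hind hE hbad

theorem measure_inter_bad_eq :
    P (R ⁻¹' E ∩ {ω | bad (R ω) (F ω) (η ω)})
      = ∫⁻ rf, E.indicator (fun _ => (P.map η) {y | bad rf.1 rf.2 y}) rf.1
          ∂(P.map fun ω => (R ω, F ω)) := by
  have hRF : Measurable fun ω => (R ω, F ω) := hR.prodMk hF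
  have := Measure.isProbabilityMeasure_map (μ := P) hη.aemeasurable
  have hlaw := (indepFun_iff_map_prod_eq_prod_map_map hRF.aemeasurable hη.aemeasurable).mp hind
  set S : Set ((𝓡 × 𝓕) × (ℕ → ℝ)) := {q | q.1.1 ∈ E} ∩ {q | bad q.1.1 q.1.2 q.2} with hS
  have hSm : MeasurableSet S := MeasurableSet.inter (hE.preimage (by fun_prop)) hbad
  have h1 : P (R ⁻¹' E ∩ {ω | bad (R ω) (F ω) (η ω)})
      = (P.map fun ω => ((R ω, F ω), η ω)) S := by
    rw [Measure.map_apply (hRF.prodMk hη) hSm]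
    rfl
  rw [h1, hlaw, Measure.prod_apply hSm]
  refine lintegral_congr fun rf => ?_
  by_cases hr : rf.1 ∈ E
  · rw [Set.indicator_of_mem hr]
    congr 1
    ext y
    simp [hS, hr]
  · rw [Set.indicator_of_notMem hr]
    have : Prod.mk rf ⁻¹' S = ∅ := by
      ext y
      simp [hS, hr]
    rw [this, measure_empty]

/-- If the noise makes `bad` happen with probability at most `δ` for almost every value of the
embedding in `E` and the objective, then `bad` has conditional probability at most `δ` given
`E`. -/
theorem measure_inter_bad_le_of_ae
    (h : ∀ᵐ ω ∂P, R ω ∈ E → (P.map η) {y | bad (R ω) (F ω) y} ≤ δ) :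
    P (R ⁻¹' E ∩ {ω | bad (R ω) (F ω) (η ω)}) ≤ δ * P (R ⁻¹' E) := by
  rw [measure_inter_bad_eq hR hF hη hind hE hbad]
  have := Measure.isProbabilityMeasure_map (μ := P) hη.aemeasurable
  have hm := measurable_indicator_measure_bad (μ := P.map η) hE hbad
  rw [lintegral_map hm (hR.prodMk hF)]
  calc _ ≤ ∫⁻ ω, (R ⁻¹' E).indicator (fun _ => δ) ω ∂P := by
        refine lintegral_mono_ae ?_
        filter_upwards [h] with ω hω
        by_cases hr : R ω ∈ E
        · simpa [hr] using hω hr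
        · simp [hr]
    _ = δ * P (R ⁻¹' E) := lintegral_indicator_const (hR hE) δ

/-- The same when the bound `δ` only holds jointly for the noise and the objective, the latter
drawn from its conditional law given the embedding. -/
theorem measure_inter_bad_le_of_condDistrib [StandardBorelSpace 𝓕] [Nonempty 𝓕]
    (h : ∀ᵐ r ∂(P.map R), r ∈ E →
      ((condDistrib F R P r).prod (P.map η)) {q | bad r q.1 q.2} ≤ δ) :
    P (R ⁻¹' E ∩ {ω | bad (R ω) (F ω) (η ω)}) ≤ δ * P (R ⁻¹' E) := by
  rw [measure_inter_bad_eq hR hF hη hind hE hbad]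
  have := Measure.isProbabilityMeasure_map (μ := P) hη.aemeasurable
  have hm := measurable_indicator_measure_bad (μ := P.map η) hE hbad
  rw [← compProd_map_condDistrib hF.aemeasurable, Measure.lintegral_compProd hm]
  calc _ ≤ ∫⁻ r, E.indicator (fun _ => δ) r ∂(P.map R) := by
        refine lintegral_mono_ae ?_
        filter_upwards [h] with r hr
        by_cases hrE : r ∈ E
        · have hb : MeasurableSet {q : 𝓕 × (ℕ → ℝ) | bad r q.1 q.2} :=
            hbad.preimage (f := fun q : 𝓕 × (ℕ → ℝ) => ((r, q.1), q.2)) (by fun_prop)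
          have hr' := hr hrE
          rw [Measure.prod_apply hb] at hr'
          simpa [hrE] using hr'
        · simp [hrE]
    _ = δ * P (R ⁻¹' E) := by
        rw [lintegral_indicator_const hE, Measure.map_apply hR hE]

end Disintegration

end CBO

theorem theorem1 :
    ∃ M : ℝ, 0 < M ∧
      ∀ {q : ℕ} (sizes : Fin q → ℕ) (_ : ∀ i, 0 < sizes i)
        (N : ℕ) (_ : N = ∏ i, sizes i)
        -- Boolean codes of the shortest possible length `m`
        (m : ℕ) (_ : IsLeast {j : ℕ | N ≤ 2 ^ j} m)
        (code : CBO.Comb sizes → Fin m → Bool) (_ : Function.Injective code)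
        -- a bounded positive definite kernel on `ℝ^d`
        (d : ℕ) (k : EuclideanSpace ℝ (Fin d) → EuclideanSpace ℝ (Fin d) → ℝ)
        (_ : Measurable (Function.uncurry k)) (_ : (Matrix.of k).PosSemidef)
        (kmax : ℝ) (_ : ∀ x x', 0 ≤ k x x' ∧ k x x' ≤ kmax)
        (δ ε σ : ℝ) (_ : 0 < δ) (_ : δ < 1) (_ : 0 < ε) (_ : ε < 1) (_ : 0 < σ)
        -- `β_t = O(√(log(N t / δ)))` with constant `A`
        (A : ℝ) (β : ℕ → ℝ)
        (_ : ∀ t : ℕ, 1 ≤ t → β t ≤ A * Real.sqrt (Real.log ((N : ℝ) * t / δ)))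
        -- initial design and rule for choosing a minimizer of the acquisition function
        (n₀ : ℕ) (init : Fin n₀ → CBO.Comb sizes)
        (argmin : (CBO.Comb sizes → ℝ) → CBO.Comb sizes) (_ : Measurable argmin)
        (_ : ∀ (g : CBO.Comb sizes → ℝ) (c : CBO.Comb sizes), g (argmin g) ≤ g c)
        -- random matrix `R`, objective `F` and independent Gaussian observation noise `η`
        (Ω : Type*) [MeasurableSpace Ω] (P : Measure Ω) [IsProbabilityMeasure P]
        (R : Ω → Fin d → Fin m → ℝ) (F : Ω → CBO.Comb sizes → ℝ) (η : ℕ → Ω → ℝ)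
        (_ : Measurable R) (_ : Measurable F) (_ : ∀ i, Measurable (η i))
        (_ : ∀ i, P.map (η i) = gaussianReal 0 (σ ^ 2).toNNReal)
        (_ : iIndepFun η P)
        (_ : IndepFun (fun ω => (R ω, F ω)) (fun ω i => η i ω) P)
        -- the embedding is of low distortion with positive probability
        (_ : P {ω | CBO.LowDistortion code ε (R ω)} ≠ 0),
        -- arbitrary (for instance non-random) objective in the RKHS, of norm at most `B`
        (∀ B : ℝ,
          (∀ᵐ ω ∂P, CBO.LowDistortion code ε (R ω) →
            CBO.InRKHSBall (CBO.pullKernel k fun c => CBO.embed (R ω) (code c)) B (F ω)) →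
          (∀ t : ℕ, 1 ≤ t → B + Real.sqrt N * CBO.baseWidth N δ t ≤ β t) →
          1 - δ ≤ (ProbabilityTheory.cond P {ω | CBO.LowDistortion code ε (R ω)}).real
            {ω | CBO.RegretBound (M * A) kmax σ ε δ N
              (CBO.cumRegret k (σ ^ 2) β (fun c => CBO.embed (R ω) (code c)) argmin init
                (F ω) (fun i => η i ω))}) ∧
        -- objective drawn from the Gaussian process prior, given the embedding
        ((∀ᵐ r ∂(P.map R), CBO.LowDistortion code ε r →
            CBO.IsGPLaw (CBO.pullKernel k fun c => CBO.embed r (code c))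
              (condDistrib F R P r)) →
          (∀ t : ℕ, 1 ≤ t → CBO.baseWidth N δ t ≤ β t) →
          1 - δ ≤ (ProbabilityTheory.cond P {ω | CBO.LowDistortion code ε (R ω)}).real
            {ω | CBO.RegretBound (M * A) kmax σ ε δ N
              (CBO.cumRegret k (σ ^ 2) β (fun c => CBO.embed (R ω) (code c)) argmin init
                (F ω) (fun i => η i ω))}) := by
  refine ⟨6, by norm_num, ?_⟩
  intro q sizes hsizes N hN m _ code _ d k hkm hkpsd kmax hkb δ ε σ hδ hδ1 hε _ hσ A β hβ n₀ init
    argmin hargm hargmin Ω _ P _ R F η hR hF hη hηlaw hηind hind hE0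
  have hne : Nonempty (CBO.Comb sizes) := ⟨fun i => ⟨0, hsizes i⟩⟩
  have hcard : N = Fintype.card (CBO.Comb sizes) := by simp [hN]
  subst hcard
  have hσ2 : 0 < σ ^ 2 := by positivity
  set E : Set (Fin d → Fin m → ℝ) := {r | CBO.LowDistortion code ε r} with hEdef
  have hEm : MeasurableSet E := CBO.measurableSet_lowDistortion code ε
  set Kr : (Fin d → Fin m → ℝ) → CBO.Comb sizes → CBO.Comb sizes → ℝ :=
    fun r => CBO.pullKernel k fun c => CBO.embed r (code c) with hKr
  have hKm : Measurable Kr := CBO.measurable_pullKernel_embed code hkm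
  have hηm : Measurable fun ω i => η i ω := measurable_pi_lambda _ hη
  have hnoise : P.map (fun ω i => η i ω) = CBO.noiseLaw (σ ^ 2).toNNReal := by
    rw [hηind.map_fun_eq_infinitePi_map₀ hηm.aemeasurable]
    simp only [hηlaw]
  have hbadm : ∀ w : ℕ → ℝ, MeasurableSet
      {q : ((Fin d → Fin m → ℝ) × (CBO.Comb sizes → ℝ)) × (ℕ → ℝ) |
        CBO.BoundFails (σ ^ 2) β w argmin init (Kr q.1.1) q.1.2 q.2} := fun w =>
    CBO.measurableSet_boundFails (hKm.comp (measurable_fst.comp measurable_fst)) (σ ^ 2) β w hargm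
      init (measurable_snd.comp measurable_fst) measurable_snd
  have hfeat : ∀ r, ∃ Φ : CBO.Comb sizes → EuclideanSpace ℝ (CBO.Comb sizes),
      ∀ c c', Kr r c c' = inner ℝ (Φ c) (Φ c') := fun r =>
    CBO.exists_featureMap (hkpsd.submatrix fun c => CBO.embed r (code c))
  -- whatever the width, the regret bound holds as soon as the confidence bound does
  have hconcl : ∀ w : ℕ → ℝ, 0 ≤ w 1 → (∀ t : ℕ, 1 ≤ t → w t ≤ β t) →
      P (R ⁻¹' E ∩ {ω | CBO.BoundFails (σ ^ 2) β w argmin init (Kr (R ω)) (F ω) fun i => η i ω})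
        ≤ ENNReal.ofReal δ * P (R ⁻¹' E) →
      1 - δ ≤ (ProbabilityTheory.cond P (R ⁻¹' E)).real
        {ω | CBO.RegretBound (6 * A) kmax σ ε δ (Fintype.card (CBO.Comb sizes))
          (CBO.cumRegret k (σ ^ 2) β (fun c => CBO.embed (R ω) (code c)) argmin init
            (F ω) (fun i => η i ω))} := by
    intro w hw0 hw hP
    refine CBO.one_sub_le_cond_real (hR hEm) hE0 (fun ω _ hω => ?_) hδ.le hP
    obtain ⟨Φ, hΦ⟩ := hfeat (R ω)
    rw [Set.mem_ofPred_eq, CBO.cumRegret_pullKernel]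
    exact CBO.regretBound_of_not_boundFails hΦ (fun c => (hkb _ _).2) hσ hδ hδ1 hβ hw0 hw hargmin
      init hω
  constructor
  · intro B hball hB
    -- `B ≥ 0` because some outcome in the event of positive probability has its objective in
    -- the ball
    have hB0 : 0 ≤ B := by
      by_contra hneg
      refine hE0 (measure_mono_null (fun ω hω => ?_) hball)
      intro hb
      obtain ⟨_, _, _, _, g, _, _, hg⟩ := (hb hω).exists_featureMap
      exact hneg ((norm_nonneg g).trans hg)
    refine hconcl (fun t => B + Real.sqrt (Fintype.card (CBO.Comb sizes)) *
      CBO.baseWidth (Fintype.card (CBO.Comb sizes)) δ t) ?_ hB ?_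
    · exact add_nonneg hB0 (mul_nonneg (Real.sqrt_nonneg _) (CBO.baseWidth_nonneg _ _ _))
    · refine CBO.measure_inter_bad_le_of_ae hR hF hηm hind hEm
          (bad := fun r f y => CBO.BoundFails (σ ^ 2) β _ argmin init (Kr r) f y) (hbadm _) ?_
      filter_upwards [hball] with ω hω hωE
      obtain ⟨H, _, _, Φ, g, hΦ, hg, hgB⟩ := (hω hωE).exists_featureMap
      rw [hnoise]
      exact CBO.noiseLaw_boundFails_le hΦ hσ2 hg hgB hδ hδ1 β hargm init
  · intro hGP hB
    refine hconcl (CBO.baseWidth (Fintype.card (CBO.Comb sizes)) δ)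
      (CBO.baseWidth_nonneg _ _ _) hB ?_
    refine CBO.measure_inter_bad_le_of_condDistrib hR hF hηm hind hEm
          (bad := fun r f y => CBO.BoundFails (σ ^ 2) β _ argmin init (Kr r) f y) (hbadm _) ?_
    filter_upwards [hGP] with r hr hrE
    obtain ⟨Φ, hΦ⟩ := hfeat r
    rw [hnoise]
    exact CBO.prod_boundFails_le hΦ hσ2 (hr hrE) hδ hδ1 β hargm init
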